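/- Let $k>1$ be an integer with $k\equiv 1$ or $5 \pmod 6$, and let $\Delta^{k-1}$ be the $(k-1)$-simplex with vertex set $\mathbb{Z}/k$. For positive integers $a,b,c$ with $a+b+c=k$ let $(a:b:c)$ denote the set of triangles $\{t,\,t+a,\,t+a+b\}$, $t\in\mathbb{Z}/k$. For $1\le l\le \frac{k-1}{2}$ put $$M_{l,k}=(l:l:k-2l),$$ and for integers $l,j$ with $1\le l<j<k-l-j$ put $$S_{l,j,k}=(l:j:k-l-j)\cup(l:k-l-j:j).$$ A set of triangles is also regarded as the simplicial complex consisting of these triangles and all their nonempty faces. Then the set of all triangles (2-dimensional faces) of $\Delta^{k-1}$ is the union of the $\frac{k-1}{2}$ sets $M_{l,k}$ and the $\frac{k^2-6k+5}{12}$ sets $S_{l,j,k}$, and all of these sets are pairwise disjoint. Moreover: 1. Each complex $M_{l,k}$ has exactly $n=\gcd(l,k)$ connected components; these are combinatorially isomorphic to each other, and each is a triangulation of the Möbius strip with exactly $k/n$ vertices. 2. Each complex $S_{l,j,k}$ has exactly $m=\gcd(l,j,k)$ connected components; these are combinatorially isomorphic to each other, and each is a triangulation of the torus with exactly $k/m$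 vertices. -/

import Mathlib

namespace CyclicSurf

section Complexes

/-- The `i`-skeleton of a simplicial complex, as the set of its `i`-dimensional faces. -/
def skel {V : Type*} (i : ℕ) (K : PreAbstractSimplicialComplex V) : Set (Finset V) :=
  {s | s ∈ K.faces ∧ s.card = i + 1}

/-- The simplicial complex generated by a set `T` of simplices: all nonempty faces of members
of `T`. -/
def generated {V : Type*} (T : Set (Finset V)) : PreAbstractSimplicialComplex V where
  faces := {s | s.Nonempty ∧ ∃ t ∈ T, s ⊆ t}
  isRelLowerSet_faces := by
    rintro s ⟨hs, t, ht, hst⟩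
    exact ⟨hs, fun u hu hne => ⟨hne, t, ht, hu.trans hst⟩⟩

/-- The vertex set of a simplicial complex. -/
def vertices {V : Type*} (K : PreAbstractSimplicialComplex V) : Set V :=
  {v | {v} ∈ K.faces}

/-- The edge graph (`1`-skeleton) on the vertices of a simplicial complex. -/
def edgeGraph {V : Type*} (K : PreAbstractSimplicialComplex V) : SimpleGraph (vertices K) where
  Adj u v := u ≠ v ∧ ∃ s ∈ K.faces, (u : V) ∈ s ∧ (v : V) ∈ s
  symm := ⟨fun _ _ ⟨hne, s, hs, hu, hv⟩ => ⟨hne.symm, s, hs, hv, hu⟩⟩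
  loopless := ⟨fun _ h => h.1 rfl⟩

/-- The connected components of a simplicial complex. -/
abbrev Component {V : Type*} (K : PreAbstractSimplicialComplex V) : Type _ :=
  (edgeGraph K).ConnectedComponent

/-- A connected component, as a subcomplex: the faces all of whose vertices lie in it. -/
def component {V : Type*} (K : PreAbstractSimplicialComplex V) (C : Component K) :
    PreAbstractSimplicialComplex V where
  faces := {s | s ∈ K.faces ∧ (s : Set V) ⊆ (fun v : vertices K => (v : V)) '' C.supp}
  isRelLowerSet_faces := by
    rintro s ⟨hs, hC⟩
    refine ⟨(K.isRelLowerSet_faces hs).1, fun u hu hne => ⟨?_, ?_⟩⟩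
    · exact (K.isRelLowerSet_faces hs).2 hu hne
    · exact fun x hx => hC (hu hx)

/-- Combinatorial isomorphism: a bijection between the vertex sets that identifies the faces. -/
def CombIso {V W : Type*} (K : PreAbstractSimplicialComplex V)
    (L : PreAbstractSimplicialComplex W) : Prop :=
  ∃ e : vertices K ≃ vertices L, ∀ s : Finset (vertices K),
    s.map (Function.Embedding.subtype _) ∈ K.faces ↔
      (s.map e.toEmbedding).map (Function.Embedding.subtype _) ∈ L.faces

/-- The geometric realization of a (finite) simplicial complex: the points in barycentric
coordinates that are convex combinations of the vertices of some face. -/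
def realization {V : Type*} (K : PreAbstractSimplicialComplex V) : Set (V → ℝ) :=
  {x | (∀ v, 0 ≤ x v) ∧ ∃ s ∈ K.faces, (∀ v, v ∉ s → x v = 0) ∧ ∑ v ∈ s, x v = 1}

/-- `K` has exactly `n` connected components, which are combinatorially isomorphic to each other,
each of them having `m` vertices and triangulating the space `X`. -/
structure IsCopies {V : Type*} (K : PreAbstractSimplicialComplex V) (n m : ℕ)
    (X : Type*) [TopologicalSpace X] : Prop where
  card_components : Nat.card (Component K) = n
  combIso : ∀ C C' : Component K, CombIso (component K C) (component K C')
  card_vertices : ∀ C : Component K, (vertices (component K C)).ncard = m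
  homeo : ∀ C : Component K, Nonempty (realization (component K C) ≃ₜ X)

end Complexes

section Spaces

open scoped unitInterval

/-- The relation `(0, y) ∼ (1, 1 - y)` on the unit square. -/
def mobiusRel (p q : I × I) : Prop :=
  p.1 = 0 ∧ q.1 = 1 ∧ q.2 = σ p.2

/-- The Möbius strip `[0, 1]² / (0, y) ∼ (1, 1 - y)`, with the quotient topology. -/
abbrev MobiusStrip : Type := Quot mobiusRel

/-- The torus `ℝ / ℤ × ℝ / ℤ`. -/
abbrev Torus : Type := UnitAddCircle × UnitAddCircle

end Spaces

section Cycles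

/-- The difference cycle `(a₀ : … : a_d)` on `n = a₀ + ⋯ + a_d` vertices: the orbit of
`{0, a₀, a₀ + a₁, …, a₀ + ⋯ + a_{d-1}}` under translations of `ℤ/n`. -/
def diffCycle (n : ℕ) {d : ℕ} (a : Fin (d + 1) → ℕ) : Set (Finset (ZMod n)) :=
  Set.range fun t : ZMod n =>
    Finset.univ.image fun i : Fin (d + 1) => t + ((∑ j ∈ Finset.Iio i, a j : ℕ) : ZMod n)

/-- `M_{l,k} = {(l : l : k - 2l)}`, as a set of triangles. -/
def M (l k : ℕ) : Set (Finset (ZMod k)) :=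
  diffCycle k ![l, l, k - 2 * l]

/-- `S_{l,j,k} = {(l : j : k - l - j), (l : k - l - j : j)}`, as a set of triangles. -/
def S (l j k : ℕ) : Set (Finset (ZMod k)) :=
  diffCycle k ![l, j, k - l - j] ∪ diffCycle k ![l, k - l - j, j]

/-- The indices `1 ≤ l ≤ (k - 1) / 2`. -/
def mobiusIndex (k : ℕ) : Finset ℕ :=
  Finset.Icc 1 ((k - 1) / 2)

/-- The indices `(l, j)` with `1 ≤ l < j < k - l - j`. -/
def torusIndex (k : ℕ) : Finset (ℕ × ℕ) :=
  {p ∈ Finset.range k ×ˢ Finset.range k | 1 ≤ p.1 ∧ p.1 < p.2 ∧ p.2 < k - p.1 - p.2}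

end Cycles

end CyclicSurf

/-! Partition: cutting the circle `ℤ/k` at the vertices of a triangle gives three positive gaps with
sum `k`, determined up to cyclic rotation. If two gaps agree, the triangle lies in a unique `M l k`.
If all differ, rotating the smallest to the front puts it in a unique `S l j k`, whose two cycles
are the two orientations of the other gaps (`skel_two_eq_union`, `disjoint_M_M`, `disjoint_S_S`,
`disjoint_M_S`). The number of `S` pieces follows from the recursion `card_torusIndex_add_six`.

Topology: each piece is the image of a simply connected triangulated surface `E` with vertex group
`W`, under the maps `c ↦ v + π c` for a homomorphism `π : W →+ ZMod k`. For `M l k` this is the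
strip `ℝ × [0, 1]` with `W = ℤ` and `π n = n l`. For `S l j k` it is the plane with `W = ℤ × ℤ` and
`π (x, y) = x l + y j`. The components are the cosets of the range of `π`, and translations identify
them. Pushing barycentric coordinates forward gives a map `develop` from `E` onto the realization of
a component. If `π` is injective on stars, the fibres of `develop` are exactly the orbits of `π.ker`
(`develop_eq_iff`), so the component is `E / π.ker` (`isCopies_pushforward`).

For the strip, the kernel is generated by the order `N` of `l` in `ZMod k`. As `k` is prime to 6,
`N` is odd and at least 5: the bound gives star injectivity, and oddness makes the generator
exchange the two boundary lines, so the quotient is a Möbius strip. For the plane, the kernel is a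
lattice of rank 2 and the quotient is a torus; star injectivity there uses `l < j < k - l - j` and
the oddness of `k`. -/

namespace CyclicSurf

/-! ### The developing map and its fibres -/

section Developing

open Function

variable {W V E : Type*} [AddCommGroup W] [AddCommGroup V]

open Classical in
/-- The pushforward of a family of barycentric coordinates along `c ↦ v + π c`. -/
noncomputable def develop (π : W →+ V) (v : V) (hat : W → E → ℝ) (p : E) (u : V) : ℝ :=
  ∑ᶠ c, if v + π c = u then hat c p else 0

open Classical in
theorem continuous_develop [TopologicalSpace E] (π : W →+ V) (v : V) {hat : W → E → ℝ}
    (hcont : ∀ c, Continuous (hat c)) (hlf : LocallyFinite fun c => support (hat c)) :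
    Continuous (develop π v hat) := by
  refine continuous_pi fun u => ?_
  refine continuous_finsum (f := fun c p => if v + π c = u then hat c p else 0) (fun c => ?_) ?_
  · by_cases h : v + π c = u
    · simpa [h] using hcont c
    · simpa [h] using continuous_const
  · refine hlf.subset fun c p hp => ?_
    simp only [mem_support, ne_eq, ite_eq_right_iff, Classical.not_imp] at hp ⊢
    exact hp.2

open Classical in
theorem develop_eq_sum (π : W →+ V) (v : V) {hat : W → E → ℝ} {p : E} {σ : Finset W}
    (h0 : ∀ c ∉ σ, hat c p = 0) (u : V) :
    develop π v hat p u = ∑ c ∈ σ, if v + π c = u then hat c p else 0 := by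
  refine finsum_eq_sum_of_support_subset _ fun c hc => ?_
  by_contra h
  simp [h0 c h] at hc

theorem develop_apply (π : W →+ V) (v : V) {hat : W → E → ℝ} {p : E} {σ : Finset W}
    (h0 : ∀ c ∉ σ, hat c p = 0) (hinj : ∀ c ∈ σ, ∀ c' ∈ σ, π c = π c' → c = c')
    {c : W} (hc : c ∈ σ) : develop π v hat p (v + π c) = hat c p := by
  rw [develop_eq_sum π v h0, Finset.sum_eq_single c]
  · simp
  · intro b hb hbc
    rw [if_neg]
    intro h
    exact hbc (hinj b hb c hc (add_left_cancel h))
  · exact fun h => absurd hc h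

theorem develop_eq_zero [DecidableEq V] (π : W →+ V) (v : V) {hat : W → E → ℝ} {p : E} {σ : Finset W}
    (h0 : ∀ c ∉ σ, hat c p = 0) {u : V} (hu : u ∉ σ.image fun c => v + π c) :
    develop π v hat p u = 0 := by
  rw [develop_eq_sum π v h0]
  refine Finset.sum_eq_zero fun c hc => if_neg fun h => hu ?_
  exact Finset.mem_image.2 ⟨c, hc, h⟩

/-- Barycentric coordinates on a space `E` triangulated by simplices `𝒯` with vertices `W`,
equivariant under translations of `W`. -/
structure BaryCoord [TopologicalSpace E] (hat : W → E → ℝ) (act : W → E → E)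
    (𝒯 : Set (Finset W)) : Prop where
  cont : ∀ c, Continuous (hat c)
  locallyFinite : LocallyFinite fun c => support (hat c)
  nonneg : ∀ c p, 0 ≤ hat c p
  cell : ∀ p, ∃ σ ∈ 𝒯, (∀ c ∉ σ, hat c p = 0) ∧ ∑ c ∈ σ, hat c p = 1
  act : ∀ c d p, hat (c + d) (act d p) = hat c p
  sep : ∀ p q, (∀ c, hat c p = hat c q) → p = q
  surj : ∀ σ ∈ 𝒯, ∀ x : W → ℝ, (∀ c, 0 ≤ x c) → (∀ c ∉ σ, x c = 0) → ∑ c ∈ σ, x c = 1 →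
    ∃ p, ∀ c, hat c p = x c

/-- The homomorphism `π` is injective on the stars of the family of simplices `𝒯`. -/
def StarInjective (π : W →+ V) (𝒯 : Set (Finset W)) : Prop :=
  ∀ σ ∈ 𝒯, ∀ τ ∈ 𝒯, ∀ s ∈ σ, ∀ t ∈ τ, π s = π t → ∀ c ∈ σ, ∀ c' ∈ τ, π c = π c' → c - s = c' - t

theorem StarInjective.injOn {π : W →+ V} {𝒯 : Set (Finset W)} (h : StarInjective π 𝒯)
    {σ : Finset W} (hσ : σ ∈ 𝒯) : ∀ c ∈ σ, ∀ c' ∈ σ, π c = π c' → c = c' := fun c hc c' hc' he =>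
  sub_left_inj.1 (h σ hσ σ hσ c hc c hc rfl c hc c' hc' he)

variable [TopologicalSpace E] {hat : W → E → ℝ} {act : W → E → E} {𝒯 : Set (Finset W)}

theorem range_develop [DecidableEq V] (B : BaryCoord hat act 𝒯) {π : W →+ V} (hinj : StarInjective π 𝒯) (v : V) :
    Set.range (develop π v hat) = {x | (∀ u, 0 ≤ x u) ∧ ∃ σ ∈ 𝒯,
      (∀ u ∉ σ.image fun c => v + π c, x u = 0) ∧ ∑ u ∈ σ.image fun c => v + π c, x u = 1} := by
  classical
  have hinj' : ∀ σ ∈ 𝒯, Set.InjOn (fun c => v + π c) (σ : Set W) := fun σ hσ c hc c' hc' he =>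
    hinj.injOn hσ c hc c' hc' (add_left_cancel he)
  ext x
  constructor
  · rintro ⟨p, rfl⟩
    obtain ⟨σ, hσ, h0, h1⟩ := B.cell p
    refine ⟨fun u => ?_, σ, hσ, fun u hu => develop_eq_zero π v h0 hu, ?_⟩
    · rw [develop_eq_sum π v h0]
      refine Finset.sum_nonneg fun c _ => ?_
      split_ifs
      · exact B.nonneg c p
      · exact le_rfl
    · rw [Finset.sum_image (hinj' σ hσ), ← h1]
      exact Finset.sum_congr rfl fun c hc => develop_apply π v h0 (hinj.injOn hσ) hc
  · rintro ⟨hx, σ, hσ, h0, h1⟩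
    rw [Finset.sum_image (hinj' σ hσ)] at h1
    obtain ⟨p, hp⟩ := B.surj σ hσ (fun c => if c ∈ σ then x (v + π c) else 0)
      (fun c => by
        split_ifs
        · exact hx _
        · exact le_rfl) (fun c hc => if_neg hc)
      (by rw [← h1]; exact Finset.sum_congr rfl fun c hc => if_pos hc)
    have hp0 : ∀ c ∉ σ, hat c p = 0 := fun c hc => by rw [hp, if_neg hc]
    refine ⟨p, funext fun u => ?_⟩
    by_cases hu : u ∈ σ.image fun c => v + π c
    · obtain ⟨c, hc, rfl⟩ := Finset.mem_image.1 hu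
      rw [develop_apply π v hp0 (hinj.injOn hσ) hc, hp, if_pos hc]
    · rw [develop_eq_zero π v hp0 hu, h0 u hu]

theorem develop_act (B : BaryCoord hat act 𝒯) {π : W →+ V} (v : V) {d : W} (hd : π d = 0) (p : E) :
    develop π v hat (act d p) = develop π v hat p := by
  funext u
  unfold develop
  rw [← finsum_comp_equiv (Equiv.addRight d)]
  refine finsum_congr fun c => ?_
  have hc : v + π (c + d) = v + π c := by rw [map_add, hd, add_zero]
  rw [Equiv.coe_addRight, B.act, hc]

/-- A vertex `s` carrying positive weight at `p` has the same image as some vertex `t` of the cell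
of `q`. The deck translation must then be `t - s`. Star injectivity says that the other matching
vertices differ by this same translation, so all barycentric coordinates agree, and these determine
the point. -/
theorem exists_act_of_develop_eq (B : BaryCoord hat act 𝒯) {π : W →+ V}
    (hinj : StarInjective π 𝒯) (v : V) {p q : E} (h : develop π v hat p = develop π v hat q) :
    ∃ d, π d = 0 ∧ act d p = q := by
  classical
  obtain ⟨σ, hσ, hσ0, hσ1⟩ := B.cell p
  obtain ⟨τ, hτ, hτ0, hτ1⟩ := B.cell q
  -- Stated for arbitrary `p` and `q` because it is used in both directions: a vanishing weight on
  -- one side has to be matched from the other.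
  have key : ∀ {p q : E} {σ τ : Finset W}, σ ∈ 𝒯 → τ ∈ 𝒯 → (∀ c ∉ σ, hat c p = 0) →
      (∀ c ∉ τ, hat c q = 0) → develop π v hat p = develop π v hat q → ∀ c, hat c p ≠ 0 →
      c ∈ σ ∧ ∃ t ∈ τ, π c = π t ∧ hat t q = hat c p := by
    intro p q σ τ hσ hτ hσ0 hτ0 h c hc
    have hcσ : c ∈ σ := by
      by_contra hn
      exact hc (hσ0 c hn)
    refine ⟨hcσ, ?_⟩
    have h1 := develop_apply π v hσ0 (hinj.injOn hσ) hcσ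
    rw [h] at h1
    have hmem : v + π c ∈ τ.image fun t => v + π t := by
      by_contra hn
      rw [develop_eq_zero π v hτ0 hn] at h1
      exact hc h1.symm
    obtain ⟨t, ht, he⟩ := Finset.mem_image.1 hmem
    have he' : π t = π c := add_left_cancel he
    refine ⟨t, ht, he'.symm, ?_⟩
    rw [← h1, ← he', develop_apply π v hτ0 (hinj.injOn hτ) ht]
  obtain ⟨s, hs, hs0⟩ : ∃ s ∈ σ, hat s p ≠ 0 := by
    by_contra! hn
    rw [Finset.sum_eq_zero hn] at hσ1
    exact zero_ne_one hσ1
  obtain ⟨-, t, ht, hst, -⟩ := key hσ hτ hσ0 hτ0 h s hs0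
  refine ⟨t - s, by rw [map_sub, hst, sub_self], B.sep _ _ fun c => ?_⟩
  have hc : hat c (act (t - s) p) = hat (c - (t - s)) p := by
    rw [← B.act (c - (t - s)) (t - s) p, sub_add_cancel]
  rw [hc]
  by_cases h1 : hat (c - (t - s)) p = 0
  · by_cases h2 : hat c q = 0
    · rw [h1, h2]
    · obtain ⟨hcτ, c', hc', he, hv⟩ := key hτ hσ hτ0 hσ0 h.symm c h2
      have := hinj τ hτ σ hσ t ht s hs hst.symm c hcτ c' hc' he
      have hcc : c - (t - s) = c' := by
        rw [← sub_add, this, sub_add_cancel]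
      rw [hcc, hv]
  · obtain ⟨hcσ, c', hc', he, hv⟩ := key hσ hτ hσ0 hτ0 h _ h1
    have := hinj σ hσ τ hτ s hs t ht hst _ hcσ c' hc' he
    have hcc : c = c' := by
      have h3 : c - t = c' - t := by rw [← this]; abel
      exact sub_left_inj.1 h3
    rw [← hv, hcc]

theorem develop_eq_iff (B : BaryCoord hat act 𝒯) {π : W →+ V} (hinj : StarInjective π 𝒯) (v : V)
    {p q : E} : develop π v hat p = develop π v hat q ↔ ∃ d, π d = 0 ∧ act d p = q := by
  refine ⟨exists_act_of_develop_eq B hinj v, ?_⟩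
  rintro ⟨d, hd, rfl⟩
  exact (develop_act B v hd p).symm

end Developing

/-! ### Components as cosets, and the quotient description of a component -/

section Components

variable {V : Type*} [AddCommGroup V] [DecidableEq V]

/-- A translation invariant family of simplices whose connected components are the cosets
of the subgroup `H`. -/
structure HasCosetComponents (T : Set (Finset V)) (H : AddSubgroup V) : Prop where
  translate : ∀ t ∈ T, ∀ a, t.image (· + a) ∈ T
  diff : ∀ t ∈ T, ∀ x ∈ t, ∀ y ∈ t, y - x ∈ H
  gen : ∃ G : Set V, H ≤ AddSubgroup.closure G ∧ ∀ g ∈ G, ∀ v, ∃ t ∈ T, v ∈ t ∧ v + g ∈ t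
  cover : ∀ v, ∃ t ∈ T, v ∈ t

namespace HasCosetComponents

variable {T : Set (Finset V)} {H : AddSubgroup V}

theorem mem_vertices (h : HasCosetComponents T H) (v : V) : v ∈ vertices (generated T) := by
  obtain ⟨t, ht, hv⟩ := h.cover v
  exact ⟨Finset.singleton_nonempty v, t, ht, Finset.singleton_subset_iff.2 hv⟩

theorem reachable_add (h : HasCosetComponents T H) {a : V} (ha : a ∈ H) (u : V) :
    (edgeGraph (generated T)).Reachable ⟨u, h.mem_vertices u⟩ ⟨u + a, h.mem_vertices _⟩ := by
  obtain ⟨G, hG, hT⟩ := h.gen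
  have ha' := hG ha
  clear ha
  induction ha' using AddSubgroup.closure_induction generalizing u with
  | mem g hg =>
    by_cases h0 : u + g = u
    · simp only [h0]; exact SimpleGraph.Reachable.refl _
    obtain ⟨t, ht, h1, h2⟩ := hT g hg u
    refine SimpleGraph.Adj.reachable ⟨fun he => h0 (congrArg Subtype.val he).symm, t, ?_, h1, h2⟩
    exact ⟨⟨u, h1⟩, t, ht, subset_rfl⟩
  | zero => simp only [add_zero]; exact SimpleGraph.Reachable.refl _
  | add x y _ _ hx hy =>
    have := (hx u).trans (hy (u + x))
    simpa only [add_assoc] using this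
  | neg x _ hx =>
    have := (hx (u + -x)).symm
    simpa only [neg_add_cancel_right] using this

theorem reachable_iff (h : HasCosetComponents T H) (u v : vertices (generated T)) :
    (edgeGraph (generated T)).Reachable u v ↔ (v : V) - u ∈ H := by
  constructor
  · rintro ⟨p⟩
    induction p with
    | nil => simp
    | cons hadj _ ih =>
      obtain ⟨-, s, ⟨-, t, ht, hst⟩, h1, h2⟩ := hadj
      have := H.add_mem ih (h.diff t ht _ (hst h1) _ (hst h2))
      simpa using this
  · intro hH
    have := h.reachable_add hH u
    simpa using this

theorem card_component (h : HasCosetComponents T H) :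
    Nat.card (Component (generated T)) = H.index := by
  have hr : ∀ u v : vertices (generated T), (edgeGraph (generated T)).Reachable u v ↔
      (QuotientAddGroup.mk (u : V) : V ⧸ H) = QuotientAddGroup.mk (v : V) := fun u v => by
    rw [h.reachable_iff, QuotientAddGroup.eq, sub_eq_neg_add]
  refine Nat.card_congr (Equiv.ofBijective
    (Quot.lift (fun v : vertices (generated T) => (QuotientAddGroup.mk (v : V) : V ⧸ H))
      fun u v huv => (hr u v).1 huv) ⟨?_, ?_⟩)
  · rintro ⟨u⟩ ⟨v⟩ huv
    exact Quot.sound ((hr u v).2 huv)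
  · intro x
    obtain ⟨v, rfl⟩ := QuotientAddGroup.mk_surjective x
    exact ⟨Quot.mk _ ⟨v, h.mem_vertices v⟩, rfl⟩

theorem mem_faces_component (h : HasCosetComponents T H) (v : vertices (generated T))
    (s : Finset V) : s ∈ (component (generated T)
      ((edgeGraph (generated T)).connectedComponentMk v)).faces ↔
      s ∈ (generated T).faces ∧ ∀ x ∈ s, x - v ∈ H := by
  refine and_congr_right fun _ => forall₂_congr fun x _ => ?_
  constructor
  · rintro ⟨y, hy, rfl⟩
    exact (h.reachable_iff v y).1 (SimpleGraph.ConnectedComponent.exact hy).symm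
  · intro hx
    refine ⟨⟨x, h.mem_vertices x⟩, ?_, rfl⟩
    exact SimpleGraph.ConnectedComponent.sound ((h.reachable_iff v ⟨x, _⟩).2 hx).symm

theorem mem_vertices_component (h : HasCosetComponents T H) (v : vertices (generated T))
    (x : V) : x ∈ vertices (component (generated T)
      ((edgeGraph (generated T)).connectedComponentMk v)) ↔ x - v ∈ H := by
  refine (h.mem_faces_component v {x}).trans ⟨fun hx => hx.2 x (by simp), fun hx => ?_⟩
  exact ⟨h.mem_vertices x, by simpa using hx⟩

theorem ncard_vertices_component (h : HasCosetComponents T H)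
    (C : Component (generated T)) :
    (vertices (component (generated T) C)).ncard = Nat.card H := by
  induction C using SimpleGraph.ConnectedComponent.ind with | _ v
  have : vertices (component (generated T)
      ((edgeGraph (generated T)).connectedComponentMk v)) = (· + (v : V)) '' (H : Set V) := by
    ext x
    rw [h.mem_vertices_component]
    constructor
    · exact fun hx => ⟨x - v, hx, by simp⟩
    · rintro ⟨y, hy, rfl⟩
      simpa using hy
  rw [this, Set.ncard_image_of_injective _ (add_left_injective _)]
  rfl

theorem image_add_mem_faces (h : HasCosetComponents T H) {s : Finset V}
    (hs : s ∈ (generated T).faces) (a : V) : s.image (· + a) ∈ (generated T).faces := by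
  obtain ⟨hne, t, ht, hst⟩ := hs
  exact ⟨hne.image _, _, h.translate t ht a, Finset.image_subset_image hst⟩

theorem combIso (h : HasCosetComponents T H) (C C' : Component (generated T)) :
    CombIso (component (generated T) C) (component (generated T) C') := by
  induction C using SimpleGraph.ConnectedComponent.ind with | _ v
  induction C' using SimpleGraph.ConnectedComponent.ind with | _ w
  let e : vertices (component (generated T)
      ((edgeGraph (generated T)).connectedComponentMk v)) ≃ vertices (component (generated T)
      ((edgeGraph (generated T)).connectedComponentMk w)) :=
    (Equiv.addRight ((w : V) - v)).subtypeEquiv fun x => by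
      refine (h.mem_vertices_component v x).trans (Iff.trans ?_ (h.mem_vertices_component w _).symm)
      rw [Equiv.coe_addRight, add_sub_assoc, sub_sub_cancel_left, sub_eq_add_neg]
  refine ⟨e, fun s => ?_⟩
  · have himage : (s.map e.toEmbedding).map (Function.Embedding.subtype _) =
        (s.map (Function.Embedding.subtype _)).image (· + ((w : V) - v)) := by
      rw [Finset.map_map, Finset.map_eq_image, Finset.map_eq_image, Finset.image_image]
      rfl
    have hcancel : ((s.map (Function.Embedding.subtype _)).image (· + ((w : V) - v))).image
        (· + -((w : V) - v)) = s.map (Function.Embedding.subtype _) := by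
      have hid : (· + -((w : V) - v)) ∘ (· + ((w : V) - v)) = id :=
        funext fun x => add_neg_cancel_right x _
      rw [Finset.image_image, hid, Finset.image_id]
    rw [himage, h.mem_faces_component, h.mem_faces_component]
    constructor
    · rintro ⟨h1, h2⟩
      refine ⟨h.image_add_mem_faces h1 _, fun x hx => ?_⟩
      obtain ⟨y, hy, rfl⟩ := Finset.mem_image.1 hx
      have := h2 y hy
      rwa [add_sub_assoc, sub_sub_cancel_left, ← sub_eq_add_neg]
    · rintro ⟨h1, h2⟩
      refine ⟨hcancel ▸ h.image_add_mem_faces h1 _, fun x hx => ?_⟩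
      have := h2 _ (Finset.mem_image_of_mem _ hx)
      rwa [add_sub_assoc, sub_sub_cancel_left, ← sub_eq_add_neg] at this

/-- A face can be enlarged to a generating simplex by adding zero coordinates. That simplex stays in
the same coset, since its vertices differ by elements of `H`. -/
theorem realization_component (h : HasCosetComponents T H) (v : vertices (generated T)) :
    realization (component (generated T) ((edgeGraph (generated T)).connectedComponentMk v)) =
      {x | (∀ u, 0 ≤ x u) ∧ ∃ t ∈ T, (∀ y ∈ t, y - v ∈ H) ∧ (∀ u ∉ t, x u = 0) ∧
        ∑ u ∈ t, x u = 1} := by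
  ext x
  refine and_congr_right fun _ => ?_
  constructor
  · rintro ⟨s, hs, h0, h1⟩
    obtain ⟨⟨⟨y, hy⟩, t, ht, hst⟩, hH⟩ := (h.mem_faces_component v s).1 hs
    refine ⟨t, ht, fun z hz => ?_, fun u hu => h0 u fun hus => hu (hst hus), ?_⟩
    · have := H.add_mem (h.diff t ht y (hst hy) z hz) (hH y hy)
      simpa using this
    · rw [← h1]
      exact (Finset.sum_subset hst fun u _ hu => h0 u hu).symm
  · rintro ⟨t, ht, hH, h0, h1⟩
    refine ⟨t, (h.mem_faces_component v t).2 ⟨⟨?_, t, ht, subset_rfl⟩, hH⟩, h0, h1⟩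
    by_contra hne
    rw [Finset.not_nonempty_iff_eq_empty.1 hne, Finset.sum_empty] at h1
    exact zero_ne_one h1

end HasCosetComponents

variable {W : Type*} [AddCommGroup W] [DecidableEq W]

/-- The translates in `V` of the images of the simplices in `𝒯`. -/
def pushforward (π : W →+ V) (𝒯 : Set (Finset W)) : Set (Finset V) :=
  {t | ∃ v, ∃ σ ∈ 𝒯, t = σ.image fun c => v + π c}

/-- A translation invariant connected family of simplices on the vertex set `W`. -/
structure IsConnectedTiling (𝒯 : Set (Finset W)) : Prop where
  nonempty : ∀ σ ∈ 𝒯, σ.Nonempty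
  translate : ∀ σ ∈ 𝒯, ∀ a, σ.image (a + ·) ∈ 𝒯
  cover : ∃ σ ∈ 𝒯, (0 : W) ∈ σ
  gen : ∃ G : Set W, AddSubgroup.closure G = ⊤ ∧ ∀ g ∈ G, ∃ σ ∈ 𝒯, (0 : W) ∈ σ ∧ g ∈ σ

variable {𝒯 : Set (Finset W)}

theorem IsConnectedTiling.hasCosetComponents (h : IsConnectedTiling 𝒯) (π : W →+ V) :
    HasCosetComponents (pushforward π 𝒯) π.range where
  translate := by
    rintro _ ⟨v, σ, hσ, rfl⟩ a
    refine ⟨v + a, σ, hσ, ?_⟩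
    rw [Finset.image_image]
    congr 1
    funext c
    simp only [Function.comp_apply]
    abel
  diff := by
    rintro _ ⟨v, σ, hσ, rfl⟩ x hx y hy
    obtain ⟨c, -, rfl⟩ := Finset.mem_image.1 hx
    obtain ⟨d, -, rfl⟩ := Finset.mem_image.1 hy
    exact ⟨d - c, by simp⟩
  gen := by
    obtain ⟨G, hG, hT⟩ := h.gen
    refine ⟨π '' G, ?_, ?_⟩
    · rw [← AddMonoidHom.map_closure, hG, AddMonoidHom.range_eq_map]
    · rintro _ ⟨g, hg, rfl⟩ v
      obtain ⟨σ, hσ, h0, h1⟩ := hT g hg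
      exact ⟨_, ⟨v, σ, hσ, rfl⟩, Finset.mem_image.2 ⟨0, h0, by simp⟩,
        Finset.mem_image.2 ⟨g, h1, rfl⟩⟩
  cover := fun v => by
    obtain ⟨σ, hσ, h0⟩ := h.cover
    exact ⟨_, ⟨v, σ, hσ, rfl⟩, Finset.mem_image.2 ⟨0, h0, by simp⟩⟩

theorem IsConnectedTiling.mem_pushforward_iff (h : IsConnectedTiling 𝒯) (π : W →+ V) (v : V)
    (t : Finset V) : (t ∈ pushforward π 𝒯 ∧ ∀ y ∈ t, y - v ∈ π.range) ↔
      ∃ σ ∈ 𝒯, t = σ.image fun c => v + π c := by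
  constructor
  · rintro ⟨⟨w, σ, hσ, rfl⟩, hH⟩
    obtain ⟨c, hc⟩ := h.nonempty σ hσ
    obtain ⟨d, hd⟩ := hH _ (Finset.mem_image_of_mem _ hc)
    -- The simplex is based at `w`, but its vertex `w + π c` equals `v + π d`; shifting `σ` by `d -
    -- c` moves the base point to `v`.
    refine ⟨_, h.translate σ hσ (d - c), ?_⟩
    rw [Finset.image_image]
    congr 1
    funext b
    simp only [Function.comp_apply, map_add, map_sub, hd]
    abel
  · rintro ⟨σ, hσ, rfl⟩
    refine ⟨⟨v, σ, hσ, rfl⟩, fun y hy => ?_⟩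
    obtain ⟨c, -, rfl⟩ := Finset.mem_image.1 hy
    exact ⟨c, by simp⟩

-- `Z` is a chart space that meets every `π.ker`-orbit of `E` through `g`, and `q` makes the same
-- identifications as `develop`. The induced map from `X` to the realization is a continuous
-- bijection from a compact space to a Hausdorff space, hence a homeomorphism.
open Topology in
theorem isCopies_pushforward {E Z X : Type*} [TopologicalSpace E] [TopologicalSpace Z]
    [TopologicalSpace X] [CompactSpace X] {hat : W → E → ℝ} {act : W → E → E}
    (hT : IsConnectedTiling 𝒯) (B : BaryCoord hat act 𝒯) {π : W →+ V} (hinj : StarInjective π 𝒯)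
    {q : Z → X} (hq : IsQuotientMap q) {g : Z → E} (hg : Continuous g)
    (hsurj : ∀ p, ∃ z d, π d = 0 ∧ act d (g z) = p)
    (hrel : ∀ v z z', q z = q z' ↔ develop π v hat (g z) = develop π v hat (g z')) :
    IsCopies (generated (pushforward π 𝒯)) π.range.index (Nat.card π.range) X := by
  have h := hT.hasCosetComponents π
  refine ⟨h.card_component, h.combIso, h.ncard_vertices_component, fun C => ?_⟩
  induction C using SimpleGraph.ConnectedComponent.ind with | _ v
  have hR : realization (component (generated (pushforward π 𝒯))
      ((edgeGraph (generated (pushforward π 𝒯))).connectedComponentMk v)) =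
      Set.range (develop π (v : V) hat) := by
    rw [h.realization_component, range_develop B hinj]
    ext x
    refine and_congr_right fun _ => ?_
    constructor
    · rintro ⟨t, ht, hH, h0⟩
      obtain ⟨σ, hσ, rfl⟩ := (hT.mem_pushforward_iff π v t).1 ⟨ht, hH⟩
      exact ⟨σ, hσ, h0⟩
    · rintro ⟨σ, hσ, h0⟩
      obtain ⟨ht, hH⟩ := (hT.mem_pushforward_iff π v _).2 ⟨σ, hσ, rfl⟩
      exact ⟨_, ht, hH, h0⟩
  rw [hR]
  let f : C(Z, Set.range (develop π (v : V) hat)) :=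
    ⟨fun z => ⟨develop π v hat (g z), g z, rfl⟩,
      ((continuous_develop π (v : V) B.cont B.locallyFinite).comp hg).subtype_mk _⟩
  have hf : ∀ z z', q z = q z' ↔ f z = f z' := fun z z' =>
    ⟨fun hz => Subtype.ext ((hrel v z z').1 hz), fun hz => (hrel v z z').2 (congrArg Subtype.val hz)⟩
  have hfac : Function.FactorsThrough f q := fun z z' hz => (hf z z').1 hz
  let qc : C(Z, X) := ⟨q, hq.continuous⟩
  have hqc : IsQuotientMap qc := hq
  let F : C(X, Set.range (develop π (v : V) hat)) := hqc.lift f hfac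
  have hF : ∀ z, F (q z) = f z := fun z => DFunLike.congr_fun (hqc.lift_comp f hfac) z
  have hbij : Function.Bijective F := by
    constructor
    · intro x y hxy
      obtain ⟨z, rfl⟩ := hq.surjective x
      obtain ⟨z', rfl⟩ := hq.surjective y
      rw [hF, hF] at hxy
      exact (hf z z').2 hxy
    · rintro ⟨_, p, rfl⟩
      obtain ⟨z, d, hd, rfl⟩ := hsurj p
      exact ⟨q z, (hF z).trans (Subtype.ext (develop_act B (v : V) hd (g z)).symm)⟩
  exact ⟨(Continuous.homeoOfEquivCompactToT2 (f := Equiv.ofBijective F hbij)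
    F.continuous).symm⟩

end Components

/-! ### Triangles of `ℤ/k` classified by their gaps -/

section Partition

variable {k : ℕ}

theorem diffCycle_three (a b c : ℕ) :
    diffCycle k ![a, b, c] =
      Set.range fun t : ZMod k => ({t, t + a, t + a + b} : Finset (ZMod k)) := by
  unfold diffCycle
  congr 1
  funext t
  have h0 : Finset.Iio (0 : Fin (2 + 1)) = ∅ := rfl
  have h1 : Finset.Iio (1 : Fin (2 + 1)) = {0} := rfl
  have h2 : Finset.Iio (2 : Fin (2 + 1)) = {0, 1} := rfl
  have hu : (Finset.univ : Finset (Fin (2 + 1))) = {0, 1, 2} := rfl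
  rw [hu, Finset.image_insert, Finset.image_insert, Finset.image_singleton, h0, h1, h2]
  simp [add_assoc]

theorem triangle_rotate {a b c : ℕ} (h : a + b + c = k) (t : ZMod k) :
    ({t, t + a, t + a + b} : Finset (ZMod k)) =
      {t + a, t + a + b, t + a + b + c} := by
  have : t + a + b + c = t := by
    have h' : ((a + b + c : ℕ) : ZMod k) = 0 := by rw [h]; simp
    push_cast at h'
    rw [add_assoc, add_assoc, ← add_assoc (a : ZMod k), h', add_zero]
  rw [this]
  ext x
  simp only [Finset.mem_insert, Finset.mem_singleton]
  tauto

theorem diffCycle_rotate {a b c : ℕ} (h : a + b + c = k) :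
    diffCycle k ![a, b, c] = diffCycle k ![b, c, a] := by
  rw [diffCycle_three, diffCycle_three]
  ext s
  constructor
  · rintro ⟨t, rfl⟩
    exact ⟨t + a, (triangle_rotate h t).symm⟩
  · rintro ⟨t, rfl⟩
    refine ⟨t - a, ?_⟩
    dsimp only
    rw [triangle_rotate h, sub_add_cancel]

theorem natCast_inj_of_lt {a b : ℕ} (ha : a < k) (hb : b < k) (h : (a : ZMod k) = b) : a = b := by
  have := (ZMod.natCast_eq_natCast_iff a b k).1 h
  exact Nat.ModEq.eq_of_lt_of_lt this ha hb

/-- Relative to `t`, the other two vertices have representatives `a < a + b` in `(0, k)`. A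
two-element set of naturals has only one increasing listing. -/
theorem gaps_eq_of_base {a b a' b' : ℕ} (ha : 0 < a) (hb : 0 < b) (hab : a + b < k) (ha' : 0 < a')
    (hb' : 0 < b') (hab' : a' + b' < k) {t : ZMod k}
    (h : ({t, t + a, t + a + b} : Finset (ZMod k)) = {t, t + a', t + a' + b'}) :
    a = a' ∧ b = b' := by
  have e1 : t + a ∈ ({t, t + a', t + a' + b'} : Finset (ZMod k)) := by rw [← h]; simp
  have e2 : t + a + b ∈ ({t, t + a', t + a' + b'} : Finset (ZMod k)) := by rw [← h]; simp
  simp only [Finset.mem_insert, Finset.mem_singleton, add_assoc, add_right_inj, add_eq_left] at e1 e2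
  have f1 : a = 0 ∨ a = a' ∨ a = a' + b' := by
    rcases e1 with e | e | e
    · have e' : ((a : ℕ) : ZMod k) = (0 : ℕ) := by simpa using e
      exact Or.inl (natCast_inj_of_lt (by omega) (by omega) e')
    · exact Or.inr (Or.inl (natCast_inj_of_lt (by omega) (by omega) e))
    · have e' : ((a : ℕ) : ZMod k) = (a' + b' : ℕ) := by push_cast; exact e
      exact Or.inr (Or.inr (natCast_inj_of_lt (by omega) (by omega) e'))
  have f2 : a + b = 0 ∨ a + b = a' ∨ a + b = a' + b' := by
    rcases e2 with e | e | e
    · have e' : ((a + b : ℕ) : ZMod k) = (0 : ℕ) := by push_cast; exact e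
      exact Or.inl (natCast_inj_of_lt (by omega) (by omega) e')
    · have e' : ((a + b : ℕ) : ZMod k) = (a' : ℕ) := by push_cast; exact e
      exact Or.inr (Or.inl (natCast_inj_of_lt (by omega) (by omega) e'))
    · have e' : ((a + b : ℕ) : ZMod k) = (a' + b' : ℕ) := by push_cast; exact e
      exact Or.inr (Or.inr (natCast_inj_of_lt (by omega) (by omega) e'))
  omega

/-- The gaps of a triangle are determined up to a cyclic rotation. -/
theorem gaps_eq_rotate {a b c a' b' c' : ℕ} (ha : 0 < a) (hb : 0 < b) (hc : 0 < c)
    (h : a + b + c = k) (ha' : 0 < a') (hb' : 0 < b') (hc' : 0 < c') (h' : a' + b' + c' = k)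
    {s : Finset (ZMod k)} (hs : s ∈ diffCycle k ![a, b, c]) (hs' : s ∈ diffCycle k ![a', b', c']) :
    (a = a' ∧ b = b' ∧ c = c') ∨ (a = b' ∧ b = c' ∧ c = a') ∨ (a = c' ∧ b = a' ∧ c = b') := by
  rw [diffCycle_three] at hs hs'
  obtain ⟨t, rfl⟩ := hs
  obtain ⟨t', he⟩ := hs'
  dsimp only at he
  have ht : t ∈ ({t', t' + a', t' + a' + b'} : Finset (ZMod k)) := by rw [he]; simp
  simp only [Finset.mem_insert, Finset.mem_singleton] at ht
  rcases ht with rfl | rfl | rfl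
  · have := gaps_eq_of_base ha hb (by omega) ha' hb' (by omega) he.symm
    omega
  · rw [triangle_rotate h'] at he
    have := gaps_eq_of_base ha hb (by omega) hb' hc' (by omega) he.symm
    omega
  · rw [triangle_rotate h', triangle_rotate (by omega : b' + c' + a' = k)] at he
    have := gaps_eq_of_base ha hb (by omega) hc' ha' (by omega) he.symm
    omega

theorem card_of_mem_diffCycle {a b c : ℕ} (ha : 0 < a) (hb : 0 < b) (hc : 0 < c)
    (h : a + b + c = k) {s : Finset (ZMod k)} (hs : s ∈ diffCycle k ![a, b, c]) : s.card = 3 := by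
  rw [diffCycle_three] at hs
  obtain ⟨t, rfl⟩ := hs
  refine Finset.card_eq_three.2 ⟨t, t + a, t + a + b, fun e => ?_, fun e => ?_, fun e => ?_, rfl⟩
  · have : a = 0 := natCast_inj_of_lt (k := k) (by omega) (by omega) (by simpa using e.symm)
    omega
  · have : a + b = 0 := natCast_inj_of_lt (k := k) (by omega) (by omega) (by
      rw [add_assoc] at e
      simpa using e.symm)
    omega
  · have : b = 0 := natCast_inj_of_lt (k := k) (by omega) (by omega) (by simpa using e.symm)
    omega

theorem mem_diffCycle_of_val_lt [NeZero k] {x y z : ZMod k} (hxy : x.val < y.val)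
    (hyz : y.val < z.val) :
    ({x, y, z} : Finset (ZMod k)) ∈
      diffCycle k ![y.val - x.val, z.val - y.val, k - (z.val - x.val)] := by
  rw [diffCycle_three]
  refine ⟨x, ?_⟩
  have e1 : x + ((y.val - x.val : ℕ) : ZMod k) = y := by
    rw [Nat.cast_sub hxy.le]; simp
  have e2 : y + ((z.val - y.val : ℕ) : ZMod k) = z := by
    rw [Nat.cast_sub hyz.le]; simp
  dsimp only
  rw [e1, e2]

theorem exists_mem_diffCycle [NeZero k] {s : Finset (ZMod k)} (hs : s.card = 3) :
    ∃ a b c : ℕ, 0 < a ∧ 0 < b ∧ 0 < c ∧ a + b + c = k ∧ s ∈ diffCycle k ![a, b, c] := by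
  have sorted : ∀ x y z : ZMod k, x.val < y.val → y.val < z.val → s = {x, y, z} →
      ∃ a b c : ℕ, 0 < a ∧ 0 < b ∧ 0 < c ∧ a + b + c = k ∧ s ∈ diffCycle k ![a, b, c] := by
    rintro x y z hxy hyz rfl
    have hz := z.val_lt
    exact ⟨_, _, _, by omega, by omega, by omega, by omega, mem_diffCycle_of_val_lt hxy hyz⟩
  obtain ⟨x, y, z, hxy, hxz, hyz, rfl⟩ := Finset.card_eq_three.1 hs
  have h1 : x.val ≠ y.val := fun e => hxy (ZMod.val_injective k e)
  have h2 : x.val ≠ z.val := fun e => hxz (ZMod.val_injective k e)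
  have h3 : y.val ≠ z.val := fun e => hyz (ZMod.val_injective k e)
  rcases lt_or_gt_of_ne h1 with h1 | h1 <;> rcases lt_or_gt_of_ne h2 with h2 | h2 <;>
    rcases lt_or_gt_of_ne h3 with h3 | h3
  · exact sorted x y z h1 h3 rfl
  · exact sorted x z y h2 h3 (by ext; simp; tauto)
  · omega
  · exact sorted z x y h2 h1 (by ext; simp; tauto)
  · exact sorted y x z h1 h2 (by ext; simp; tauto)
  · omega
  · exact sorted y z x h3 h2 (by ext; simp; tauto)
  · exact sorted z y x h3 h1 (by ext; simp; tauto)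

theorem mem_mobiusIndex {l : ℕ} : l ∈ mobiusIndex k ↔ 1 ≤ l ∧ l ≤ (k - 1) / 2 := by
  simp [mobiusIndex]

theorem mem_torusIndex {p : ℕ × ℕ} :
    p ∈ torusIndex k ↔ 1 ≤ p.1 ∧ p.1 < p.2 ∧ p.2 < k - p.1 - p.2 := by
  simp only [torusIndex, Finset.mem_filter, Finset.mem_product, Finset.mem_range]
  omega

theorem diffCycle_subset_M {a b : ℕ} (h : a + a + b = k) : diffCycle k ![a, a, b] = M a k := by
  have : b = k - 2 * a := by omega
  rw [this]; rfl

theorem diffCycle_subset_S_left {l j c : ℕ} (h : l + j + c = k) :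
    diffCycle k ![l, j, c] ⊆ S l j k := by
  have : c = k - l - j := by omega
  rw [this]; exact Set.subset_union_left

theorem diffCycle_subset_S_right {l j c : ℕ} (h : l + j + c = k) :
    diffCycle k ![l, c, j] ⊆ S l j k := by
  have : c = k - l - j := by omega
  rw [this]; exact Set.subset_union_right

theorem skel_two_eq_union (hk : 1 < k) :
    skel 2 (⊤ : PreAbstractSimplicialComplex (ZMod k)) =
      (⋃ l ∈ mobiusIndex k, M l k) ∪ (⋃ p ∈ torusIndex k, S p.1 p.2 k) := by
  have : NeZero k := ⟨by omega⟩
  ext s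
  simp only [Set.mem_union, Set.mem_iUnion, exists_prop]
  constructor
  · rintro ⟨-, hs⟩
    obtain ⟨a, b, c, ha, hb, hc, h, hm⟩ := exists_mem_diffCycle hs
    have h1 : b + c + a = k := by omega
    have h2 : c + a + b = k := by omega
    have hm1 := hm
    rw [diffCycle_rotate h] at hm1
    have hm2 := hm1
    rw [diffCycle_rotate h1] at hm2
    have iso : ∀ x y : ℕ, 0 < x → 0 < y → x + x + y = k → s ∈ diffCycle k ![x, x, y] →
        (∃ l, l ∈ mobiusIndex k ∧ s ∈ M l k) ∨ ∃ p, p ∈ torusIndex k ∧ s ∈ S p.1 p.2 k := by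
      intro x y hx hy hxy hmem
      refine Or.inl ⟨x, mem_mobiusIndex.2 (by omega), ?_⟩
      rwa [← diffCycle_subset_M hxy]
    have scal : ∀ x y z : ℕ, 0 < x → x < y → x < z → y ≠ z → x + y + z = k →
        s ∈ diffCycle k ![x, y, z] →
        (∃ l, l ∈ mobiusIndex k ∧ s ∈ M l k) ∨ ∃ p, p ∈ torusIndex k ∧ s ∈ S p.1 p.2 k := by
      intro x y z hx hxy hxz hyz hsum hmem
      rcases lt_or_gt_of_ne hyz with hlt | hlt
      · exact Or.inr ⟨(x, y), mem_torusIndex.2 (by dsimp only; omega),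
          diffCycle_subset_S_left hsum hmem⟩
      · exact Or.inr ⟨(x, z), mem_torusIndex.2 (by dsimp only; omega),
          diffCycle_subset_S_right (by omega) hmem⟩
    by_cases hab : a = b
    · subst hab; exact iso a c ha hc h hm
    by_cases hbc : b = c
    · subst hbc; exact iso b a hb ha h1 hm1
    by_cases hca : c = a
    · subst hca; exact iso c b hc hb h2 hm2
    by_cases hA : a < b ∧ a < c
    · exact scal a b c ha hA.1 hA.2 hbc h hm
    by_cases hB : b < c ∧ b < a
    · exact scal b c a hb hB.1 hB.2 hca h1 hm1
    · exact scal c a b hc (by omega) (by omega) hab h2 hm2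
  · have hcard : s.card = 3 → s ∈ skel 2 (⊤ : PreAbstractSimplicialComplex (ZMod k)) := by
      intro hc
      refine ⟨?_, hc⟩
      have : s.Nonempty := Finset.card_pos.1 (by omega)
      exact this
    rintro (⟨l, hl, hs⟩ | ⟨p, hp, hs⟩)
    · rw [mem_mobiusIndex] at hl
      exact hcard (card_of_mem_diffCycle (by omega) (by omega) (by omega) (by omega) hs)
    · rw [mem_torusIndex] at hp
      rcases hs with hs | hs <;>
      exact hcard (card_of_mem_diffCycle (by omega) (by omega) (by omega) (by omega) hs)

/-- Two of the three gaps are `l` and two are `l'`, so any rotation aligns some `l` with some `l'`.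
-/
theorem disjoint_M_M (hmod : k % 6 = 1 ∨ k % 6 = 5) {l l' : ℕ}
    (hl : l ∈ mobiusIndex k) (hl' : l' ∈ mobiusIndex k) (hne : l ≠ l') :
    Disjoint (M l k) (M l' k) := by
  rw [mem_mobiusIndex] at hl hl'
  refine Set.disjoint_left.2 fun s hs hs' => ?_
  have := gaps_eq_rotate (by omega) (by omega) (by omega) (by omega) (by omega) (by omega)
    (by omega) (by omega) hs hs'
  omega

/-- The strictly smallest gap fixes the rotation and the first index; the second index is the middle
one among the three gaps. -/
theorem disjoint_S_S {p q : ℕ × ℕ}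
    (hp : p ∈ torusIndex k) (hq : q ∈ torusIndex k) (hne : p ≠ q) :
    Disjoint (S p.1 p.2 k) (S q.1 q.2 k) := by
  rw [mem_torusIndex] at hp hq
  have hne' : ¬ (p.1 = q.1 ∧ p.2 = q.2) := fun h => hne (Prod.ext h.1 h.2)
  refine Set.disjoint_left.2 fun s hs hs' => ?_
  rcases hs with hs | hs <;> rcases hs' with hs' | hs' <;>
  · have := gaps_eq_rotate (by omega) (by omega) (by omega) (by omega) (by omega) (by omega)
      (by omega) (by omega) hs hs'
    omega

/-- Two gaps coincide on the left, while all three are distinct on the right. -/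
theorem disjoint_M_S {l : ℕ} {p : ℕ × ℕ}
    (hl : l ∈ mobiusIndex k) (hp : p ∈ torusIndex k) : Disjoint (M l k) (S p.1 p.2 k) := by
  rw [mem_mobiusIndex] at hl
  rw [mem_torusIndex] at hp
  refine Set.disjoint_left.2 fun s hs hs' => ?_
  rcases hs' with hs' | hs' <;>
  · have := gaps_eq_rotate (by omega) (by omega) (by omega) (by omega) (by omega) (by omega)
      (by omega) (by omega) hs hs'
    omega

end Partition

/-! ### The number of pieces -/

section Counting

theorem card_mobiusIndex {k : ℕ} (hk : k % 2 = 1) :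
    ((mobiusIndex k).card : ℚ) = ((k : ℚ) - 1) / 2 := by
  obtain ⟨m, rfl⟩ : ∃ m, k = 2 * m + 1 := ⟨k / 2, by omega⟩
  simp [mobiusIndex]

/-- Subtracting 2 from each of the three gaps matches the indices with `l ≥ 3` to those for `k`.
What remains is `l = 1` with `(k + 1) / 2` choices of `j`, and `l = 2` with `(k - 1) / 2`; together
these are `k`. -/
theorem card_torusIndex_add_six {k : ℕ} (hk : k % 2 = 1) :
    (torusIndex (k + 6)).card = (torusIndex k).card + k := by
  have h : torusIndex (k + 6) =
      ((torusIndex k).map (addRightEmbedding (2, 2)) ∪ ({1} ×ˢ Finset.Ioo 1 ((k + 5) / 2))) ∪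
        ({2} ×ˢ Finset.Ioo 2 ((k + 5) / 2)) := by
    ext ⟨l, j⟩
    simp only [mem_torusIndex, Finset.mem_union, Finset.mem_map, addRightEmbedding_apply, Prod.mk_add_mk,
      Prod.mk.injEq, Prod.exists, Finset.mem_product, Finset.mem_singleton, Finset.mem_Ioo]
    constructor
    · intro h
      by_cases h1 : l = 1
      · left; right; omega
      by_cases h2 : l = 2
      · right; omega
      · left; left; exact ⟨l - 2, j - 2, by omega, by omega, by omega⟩
    · rintro ((⟨a, b, h⟩ | h) | h) <;> omega
  rw [h, Finset.card_union_of_disjoint, Finset.card_union_of_disjoint, Finset.card_map,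
    Finset.card_product, Finset.card_product]
  · simp
    omega
  · rw [Finset.disjoint_left]
    rintro ⟨l, j⟩
    simp only [mem_torusIndex, Finset.mem_map, addRightEmbedding_apply, Prod.mk_add_mk,
      Prod.mk.injEq, Prod.exists, Finset.mem_product, Finset.mem_singleton, Finset.mem_Ioo]
    rintro ⟨a, b, h⟩
    omega
  · rw [Finset.disjoint_left]
    rintro ⟨l, j⟩
    simp only [mem_torusIndex, Finset.mem_map, addRightEmbedding_apply, Prod.mk_add_mk, Finset.mem_union,
      Prod.mk.injEq, Prod.exists, Finset.mem_product, Finset.mem_singleton, Finset.mem_Ioo]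
    rintro (⟨a, b, h⟩ | h) <;> omega

/-- The quadratic `(k ^ 2 - 6 k + 5) / 12` also grows by `k` when `k` is replaced by `k + 6`. The
induction starts at its roots 1 and 5, where there are no indices. -/
theorem card_torusIndex_of_mod {r : ℕ} (hr : r % 2 = 1) (h : torusIndex r = ∅)
    (h0 : (r : ℚ) ^ 2 - 6 * r + 5 = 0) (q : ℕ) :
    ((torusIndex (r + 6 * q)).card : ℚ) =
      (((r + 6 * q : ℕ) : ℚ) ^ 2 - 6 * ((r + 6 * q : ℕ) : ℚ) + 5) / 12 := by
  induction q with
  | zero => simp [h, h0]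
  | succ q ih =>
    have e : r + 6 * (q + 1) = r + 6 * q + 6 := by ring
    rw [e, card_torusIndex_add_six (by omega), Nat.cast_add, ih]
    push_cast
    ring

theorem card_torusIndex {k : ℕ} (hmod : k % 6 = 1 ∨ k % 6 = 5) :
    ((torusIndex k).card : ℚ) = ((k : ℚ) ^ 2 - 6 * k + 5) / 12 := by
  have hk := Nat.mod_add_div k 6
  rcases hmod with h | h <;> rw [h] at hk <;> rw [← hk]
  · exact card_torusIndex_of_mod (by omega)
      (Finset.eq_empty_of_forall_notMem fun p hp => by rw [mem_torusIndex] at hp; omega)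
      (by norm_num) _
  · exact card_torusIndex_of_mod (by omega)
      (Finset.eq_empty_of_forall_notMem fun p hp => by rw [mem_torusIndex] at hp; omega)
      (by norm_num) _

end Counting

/-! ### Barycentric coordinates from explicit triangles -/

section Cells

variable {W E ι : Type*} [DecidableEq W]

/-- The triangles with vertices `vert i 0`, `vert i 1`, `vert i 2`. -/
def triangles (vert : ι → Fin 3 → W) : Set (Finset W) :=
  Set.range fun i => {vert i 0, vert i 1, vert i 2}

/-- The functions `hat` take the values `x 0`, `x 1`, `x 2` at the vertices of a triangle, and
vanish at the other vertices. -/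
structure HatValues (hat : W → E → ℝ) (v : Fin 3 → W) (x₀ x₁ x₂ : ℝ) (p : E) : Prop where
  val₀ : hat (v 0) p = x₀
  val₁ : hat (v 1) p = x₁
  val₂ : hat (v 2) p = x₂
  other : ∀ c, c ≠ v 0 → c ≠ v 1 → c ≠ v 2 → hat c p = 0

theorem sum_triangle {M : Type*} [AddCommMonoid M] {v : Fin 3 → W} (hv : Function.Injective v)
    (f : W → M) : ∑ c ∈ ({v 0, v 1, v 2} : Finset W), f c = f (v 0) + (f (v 1) + f (v 2)) := by
  rw [Finset.sum_insert, Finset.sum_insert, Finset.sum_singleton]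
  · simp [hv.eq_iff]
  · simp [hv.eq_iff]

theorem HatValues.eq_zero {hat : W → E → ℝ} {v : Fin 3 → W} {x₀ x₁ x₂ : ℝ} {p : E}
    (h : HatValues hat v x₀ x₁ x₂ p) : ∀ c ∉ ({v 0, v 1, v 2} : Finset W), hat c p = 0 := by
  intro c hc
  simp only [Finset.mem_insert, Finset.mem_singleton, not_or] at hc
  exact h.other c hc.1 hc.2.1 hc.2.2

theorem HatValues.finsum_smul {hat : W → E → ℝ} {v : Fin 3 → W} (hv : Function.Injective v)
    {x₀ x₁ x₂ : ℝ} {p : E} (h : HatValues hat v x₀ x₁ x₂ p) (wt : W → ℝ × ℝ) :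
    ∑ᶠ c, hat c p • wt c = x₀ • wt (v 0) + (x₁ • wt (v 1) + x₂ • wt (v 2)) := by
  rw [finsum_eq_sum_of_support_subset (s := {v 0, v 1, v 2}), sum_triangle hv, h.val₀, h.val₁,
    h.val₂]
  intro c hc
  by_contra hn
  exact hc (by dsimp only; rw [h.eq_zero c hn, zero_smul])

/-- Barycentric coordinates given by a parametrization of each triangle. -/
theorem BaryCoord.of_triangles [AddCommGroup W] [TopologicalSpace E] {hat : W → E → ℝ} {act : W → E → E}
    {vert : ι → Fin 3 → W} (hvert : ∀ i, Function.Injective (vert i)) (pos : W → ℝ × ℝ)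
    {coord : E → ℝ × ℝ} (hcoord : Function.Injective coord)
    (cont : ∀ c, Continuous (hat c))
    (locallyFinite : LocallyFinite fun c => Function.support (hat c))
    (nonneg : ∀ c p, 0 ≤ hat c p)
    (hact : ∀ c d p, hat (c + d) (act d p) = hat c p)
    (cell : ∀ p, ∃ i x₀ x₁ x₂, x₀ + x₁ + x₂ = 1 ∧ HatValues hat (vert i) x₀ x₁ x₂ p ∧
      coord p = x₀ • pos (vert i 0) + (x₁ • pos (vert i 1) + x₂ • pos (vert i 2)))
    (surj : ∀ i x₀ x₁ x₂, 0 ≤ x₀ → 0 ≤ x₁ → 0 ≤ x₂ → x₀ + x₁ + x₂ = 1 →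
      ∃ p, HatValues hat (vert i) x₀ x₁ x₂ p) :
    BaryCoord hat act (triangles vert) where
  cont := cont
  locallyFinite := locallyFinite
  nonneg := nonneg
  act := hact
  cell p := by
    obtain ⟨i, x₀, x₁, x₂, h1, h, -⟩ := cell p
    refine ⟨_, ⟨i, rfl⟩, h.eq_zero, ?_⟩
    rw [sum_triangle (hvert i), h.val₀, h.val₁, h.val₂, ← h1, add_assoc]
  sep := by
    -- A point is the weighted sum of the vertex positions, so its weights determine it.
    have key : ∀ p, coord p = ∑ᶠ c, hat c p • pos c := fun p => by
      obtain ⟨i, x₀, x₁, x₂, -, h, h2⟩ := cell p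
      rw [h2, h.finsum_smul (hvert i)]
    intro p q hpq
    apply hcoord
    rw [key, key]
    exact finsum_congr fun c => by rw [hpq]
  surj := by
    rintro _ ⟨i, rfl⟩ x hx h0 h1
    rw [sum_triangle (hvert i)] at h1
    obtain ⟨p, hp⟩ := surj i _ _ _ (hx (vert i 0)) (hx (vert i 1)) (hx (vert i 2))
      (by rw [← h1, add_assoc])
    refine ⟨p, fun c => ?_⟩
    by_cases hc : c ∈ ({vert i 0, vert i 1, vert i 2} : Finset W)
    · simp only [Finset.mem_insert, Finset.mem_singleton] at hc
      rcases hc with rfl | rfl | rfl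
      · exact hp.val₀
      · exact hp.val₁
      · exact hp.val₂
    · rw [hp.eq_zero c hc, h0 c hc]

end Cells

/-! ### The triangulated strip and the Möbius pieces -/

section Strip

/-- The reflection of the interval `[0, 1]` by the parity of `c`. -/
noncomputable def flip (c : ℤ) (y : ℝ) : ℝ := if Even c then y else 1 - y

theorem flip_add (c d : ℤ) (y : ℝ) : flip (c + d) y = flip d (flip c y) := by
  by_cases hc : Even c <;> by_cases hd : Even d <;> simp [flip, hc, hd, Int.even_add]

theorem flip_flip (c : ℤ) (y : ℝ) : flip c (flip c y) = y := by
  by_cases hc : Even c <;> simp [flip, hc]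

theorem flip_mem (c : ℤ) {y : ℝ} (hy : y ∈ unitInterval) : flip c y ∈ unitInterval := by
  obtain ⟨h0, h1⟩ := hy
  by_cases hc : Even c
  · simpa [flip, hc] using ⟨h0, h1⟩
  · simpa [flip, hc] using ⟨h1, h0⟩

theorem continuous_flip (c : ℤ) : Continuous (flip c) := by
  by_cases hc : Even c
  · have : flip c = id := by funext y; simp [flip, hc]
    rw [this]
    exact continuous_id
  · have : flip c = fun y => 1 - y := by funext y; simp [flip, hc]
    rw [this]
    fun_prop

/-- The barycentric coordinate of the vertex `(0, 0)` in the strip `ℝ × [0, 1]` with vertices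
`(c, c mod 2)`. -/
noncomputable def tent (x y : ℝ) : ℝ := max 0 (min (1 - y) (1 - (y + |x|) / 2))

theorem continuous_tent : Continuous fun p : ℝ × ℝ => tent p.1 p.2 := by
  unfold tent
  fun_prop

/-- The hypotheses cut out the triangle with vertices `(0, 0)`, `(1, 1)`, `(2, 0)`. This lemma and
the next two compute its three barycentric coordinates. -/
theorem tent_zero {x y : ℝ} (h1 : y ≤ x) (h2 : x ≤ 2 - y) (h0 : 0 ≤ y) :
    tent x y = 1 - (x + y) / 2 := by
  unfold tent
  rw [abs_of_nonneg (by linarith), min_eq_right (by linarith), max_eq_right (by linarith)]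
  ring

theorem tent_one {x y : ℝ} (h1 : y ≤ x) (h2 : x ≤ 2 - y) (h0 : 0 ≤ y) :
    tent (x - 1) (1 - y) = y := by
  unfold tent
  have : |x - 1| ≤ 1 - y := abs_le.2 ⟨by linarith, by linarith⟩
  rw [min_eq_left (by linarith), max_eq_right (by linarith)]
  ring

theorem tent_two {x y : ℝ} (h1 : y ≤ x) (h2 : x ≤ 2 - y) (h0 : 0 ≤ y) :
    tent (x - 2) y = (x - y) / 2 := by
  unfold tent
  rw [abs_of_nonpos (by linarith), min_eq_right (by linarith), max_eq_right (by linarith)]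
  ring

theorem tent_eq_zero {x y : ℝ} (h : 2 ≤ y + |x|) : tent x y = 0 := by
  unfold tent
  exact max_eq_left ((min_le_right _ _).trans (by linarith))

theorem tent_eq_zero_of_far {x y : ℝ} (h1 : y ≤ x) (h2 : x ≤ 2 - y) (h0 : 0 ≤ y) {m : ℤ} (hm0 : m ≠ 0)
    (hm1 : m ≠ 1) (hm2 : m ≠ 2) : tent (x - m) (flip m y) = 0 := by
  apply tent_eq_zero
  by_cases hm : Even m
  · rw [flip, if_pos hm]
    obtain ⟨n, rfl⟩ := hm
    rcases (by omega : n ≤ -1 ∨ 2 ≤ n) with h | h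
    · have : (n : ℝ) ≤ -1 := by exact_mod_cast h
      have := le_abs_self (x - (n + n : ℤ))
      push_cast at *
      linarith
    · have : (2 : ℝ) ≤ n := by exact_mod_cast h
      have := neg_abs_le (x - (n + n : ℤ))
      push_cast at *
      linarith
  · rw [flip, if_neg hm]
    rw [Int.not_even_iff_odd] at hm
    obtain ⟨n, rfl⟩ := hm
    rcases (by omega : n ≤ -1 ∨ 1 ≤ n) with h | h
    · have : (n : ℝ) ≤ -1 := by exact_mod_cast h
      have := le_abs_self (x - (2 * n + 1 : ℤ))
      push_cast at *
      linarith
    · have : (1 : ℝ) ≤ n := by exact_mod_cast h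
      have := neg_abs_le (x - (2 * n + 1 : ℤ))
      push_cast at *
      linarith

/-- The barycentric coordinates on the strip `ℝ × [0, 1]` with vertices `(c, c mod 2)`. -/
noncomputable def stripHat (c : ℤ) (p : ℝ × unitInterval) : ℝ := tent (p.1 - c) (flip c p.2)

/-- The glide reflection of the strip `ℝ × [0, 1]` moving the vertex `c` to `c + d`. -/
noncomputable def stripAct (d : ℤ) (p : ℝ × unitInterval) : ℝ × unitInterval :=
  (d + p.1, ⟨flip d p.2, flip_mem d p.2.2⟩)

/-- The vertices of the triangles of the strip. -/
def stripVert (c : ℤ) (i : Fin 3) : ℤ := c + (i : ℕ)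

/-- The glide reflection by `c` reduces everything to the model triangle at `c = 0`. -/
theorem stripHat_values {c : ℤ} {p : ℝ × unitInterval} (h1 : flip c p.2 ≤ p.1 - c)
    (h2 : p.1 - c ≤ 2 - flip c p.2) :
    HatValues stripHat (stripVert c) (1 - (p.1 - c + flip c p.2) / 2) (flip c p.2)
      ((p.1 - c - flip c p.2) / 2) p := by
  have h0 := (flip_mem c p.2.2).1
  have hadd : ∀ m : ℤ, stripHat (c + m) p = tent (p.1 - c - m) (flip m (flip c p.2)) := fun m => by
    rw [stripHat, flip_add]
    congr 1
    push_cast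
    ring
  have e0 : stripVert c 0 = c := by simp [stripVert]
  have e1 : stripVert c 1 = c + 1 := by simp [stripVert]
  have e2 : stripVert c 2 = c + 2 := by simp [stripVert]
  refine ⟨?_, ?_, ?_, fun d hd0 hd1 hd2 => ?_⟩
  · rw [e0]
    exact tent_zero h1 h2 h0
  · rw [e1, hadd]
    simpa [flip] using tent_one h1 h2 h0
  · rw [e2, hadd]
    simpa [flip] using tent_two h1 h2 h0
  · obtain ⟨m, rfl⟩ : ∃ m, d = c + m := ⟨d - c, by ring⟩
    rw [hadd]
    rw [e0] at hd0
    rw [e1] at hd1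
    rw [e2] at hd2
    exact tent_eq_zero_of_far h1 h2 h0 (by omega) (by omega) (by omega)

theorem locallyFinite_stripHat : LocallyFinite fun c => Function.support (stripHat c) := by
  intro p
  refine ⟨{z | |z.1 - p.1| < 1}, ?_, ?_⟩
  · refine IsOpen.mem_nhds (isOpen_lt (by fun_prop) continuous_const) ?_
    simp
  · refine (Set.finite_Icc (⌊p.1⌋ - 3) (⌊p.1⌋ + 4)).subset ?_
    rintro c ⟨z, hz, hzp⟩
    have hzc : |z.1 - c| < 2 := by
      by_contra hn
      refine hz (tent_eq_zero ?_)
      have := (flip_mem c z.2.2).1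
      linarith [not_lt.1 hn]
    have hzp' : |z.1 - p.1| < 1 := hzp
    rw [abs_lt] at hzc hzp'
    have := Int.floor_le p.1
    have := Int.lt_floor_add_one p.1
    constructor
    · have : (⌊p.1⌋ : ℝ) - 3 < c := by linarith
      exact_mod_cast this.le
    · have : (c : ℝ) < ⌊p.1⌋ + 4 := by linarith
      exact_mod_cast this.le

theorem exists_strip_cell (p : ℝ × unitInterval) :
    ∃ c : ℤ, flip c p.2 ≤ p.1 - c ∧ p.1 - c ≤ 2 - flip c p.2 := by
  have hy := flip_mem ⌊p.1⌋ p.2.2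
  have hf0 := Int.floor_le p.1
  have hf1 := Int.lt_floor_add_one p.1
  -- Over the unit interval starting at `⌊p.1⌋`, an edge separates the triangle beginning at `⌊p.1⌋`
  -- from the one beginning one step earlier.
  by_cases h : flip ⌊p.1⌋ p.2 ≤ p.1 - ⌊p.1⌋
  · exact ⟨⌊p.1⌋, h, by linarith [hy.2]⟩
  · have : flip (⌊p.1⌋ + (-1)) p.2 = 1 - flip ⌊p.1⌋ p.2 := by
      rw [flip_add]
      simp [flip]
    refine ⟨⌊p.1⌋ + (-1), ?_, ?_⟩ <;> rw [this] <;> push_cast <;> linarith [hy.1, hy.2]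

theorem stripVert_injective (c : ℤ) : Function.Injective (stripVert c) := fun i j h => by
  simpa [stripVert, Fin.ext_iff] using h

theorem baryCoord_strip : BaryCoord stripHat stripAct (triangles stripVert) := by
  refine BaryCoord.of_triangles stripVert_injective
    (fun c => ((c : ℝ), if Even c then 0 else 1)) (coord := fun p => (p.1, (p.2 : ℝ)))
    (fun p q h => ?_) (fun c => ?_) locallyFinite_stripHat (fun c p => le_max_left _ _)
    (fun c d p => ?_) (fun p => ?_) fun c x₀ x₁ x₂ h0 h1 h2 hs => ?_
  · simp only [Prod.mk.injEq] at h
    exact Prod.ext h.1 (Subtype.ext h.2)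
  · have := continuous_flip c
    exact continuous_tent.comp (f := fun p : ℝ × unitInterval => (p.1 - c, flip c p.2)) (by fun_prop)
  · simp only [stripHat, stripAct]
    rw [add_comm c d, flip_add, flip_flip]
    congr 1
    push_cast
    ring
  · obtain ⟨c, h1, h2⟩ := exists_strip_cell p
    refine ⟨c, _, _, _, by ring, stripHat_values h1 h2, ?_⟩
    by_cases hc : Even c
    · ext
      · simp [stripVert]; ring
      · simp [stripVert, flip, hc]
    · ext
      · simp [stripVert]; ring
      · have h2 : ¬ Even (c + 2) := by rw [Int.even_add]; simp [hc]
        have h1 : Even (c + 1) := by rw [Int.even_add]; simp [hc]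
        simp [stripVert, flip, hc, h1, h2]; ring
  · have hy : flip c x₁ ∈ unitInterval := flip_mem c ⟨h1, by linarith⟩
    refine ⟨(c + x₁ + 2 * x₂, ⟨flip c x₁, hy⟩), ?_⟩
    have := @stripHat_values c (c + x₁ + 2 * x₂, ⟨flip c x₁, hy⟩)
      (by simp only [flip_flip]; linarith) (by simp only [flip_flip]; linarith)
    simp only [flip_flip] at this
    convert this using 1
    · linarith
    · ring

theorem isConnectedTiling_strip : IsConnectedTiling (triangles stripVert) where
  nonempty := by
    rintro _ ⟨c, rfl⟩
    exact ⟨_, Finset.mem_insert_self _ _⟩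
  translate := by
    rintro _ ⟨c, rfl⟩ a
    refine ⟨a + c, ?_⟩
    simp [Finset.image_insert, stripVert, add_assoc]
  cover := ⟨_, ⟨0, rfl⟩, by simp [stripVert]⟩
  gen := ⟨{1}, (AddSubgroup.eq_top_iff' _).2 fun n =>
    AddSubgroup.mem_closure_singleton.2 ⟨n, by simp⟩, by
    rintro _ rfl
    exact ⟨_, ⟨0, rfl⟩, by simp [stripVert], by simp [stripVert]⟩⟩

theorem sub_mem_strip {σ : Finset ℤ} (hσ : σ ∈ triangles stripVert) {s c : ℤ} (hs : s ∈ σ)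
    (hc : c ∈ σ) : -2 ≤ c - s ∧ c - s ≤ 2 := by
  obtain ⟨a, rfl⟩ := hσ
  simp only [stripVert, Finset.mem_insert, Finset.mem_singleton] at hs hc
  simp at hs hc
  omega

/-- Multiplication by `l` on `ℤ`, with values in `ℤ/k`. -/
def stripHom (l k : ℕ) : ℤ →+ ZMod k := zmultiplesHom (ZMod k) (l : ZMod k)

theorem stripHom_apply (l k : ℕ) (n : ℤ) : stripHom l k n = n * l := by
  simp [stripHom]

theorem stripHom_eq_zero_iff (l k : ℕ) (n : ℤ) :
    stripHom l k n = 0 ↔ (addOrderOf (l : ZMod k) : ℤ) ∣ n := by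
  rw [addOrderOf_dvd_iff_zsmul_eq_zero]
  simp [stripHom]

/-- Two vertices of a triangle differ by at most 2, so two such differences are at most 4 apart. A
nonzero kernel element has absolute value at least 5. -/
theorem starInjective_strip {l k : ℕ} (h : 5 ≤ addOrderOf (l : ZMod k)) :
    StarInjective (stripHom l k) (triangles stripVert) := by
  intro σ hσ τ hτ s hs t ht hst c hc c' hc' hcc
  have h1 := sub_mem_strip hσ hs hc
  have h2 := sub_mem_strip hτ ht hc'
  have h3 : stripHom l k (c - s - (c' - t)) = 0 := by
    simp only [map_sub, hst, hcc, sub_self]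
  rw [stripHom_eq_zero_iff] at h3
  have := Int.eq_zero_of_abs_lt_dvd h3 (by rw [abs_lt]; omega)
  omega

theorem M_eq_pushforward (l k : ℕ) : M l k = pushforward (stripHom l k) (triangles stripVert) := by
  rw [M, diffCycle_three]
  ext s
  constructor
  · rintro ⟨t, rfl⟩
    refine ⟨t, _, ⟨0, rfl⟩, ?_⟩
    simp [Finset.image_insert, stripVert, stripHom_apply, two_mul, add_assoc]
  · rintro ⟨t, _, ⟨c, rfl⟩, rfl⟩
    refine ⟨t + c * l, ?_⟩
    simp [Finset.image_insert, stripVert, stripHom_apply, two_mul, add_mul, add_assoc]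

theorem isCopies_M {l k : ℕ} (h : 5 ≤ addOrderOf (l : ZMod k))
    (hodd : Odd (addOrderOf (l : ZMod k))) :
    IsCopies (generated (M l k)) (stripHom l k).range.index (Nat.card (stripHom l k).range)
      MobiusStrip := by
  rw [M_eq_pushforward]
  set N := addOrderOf (l : ZMod k) with hN
  have hNpos : (0 : ℝ) < N := by
    have : 0 < N := by omega
    exact_mod_cast this
  have hinj := starInjective_strip h
  -- Since `N` is odd, the generator of the kernel turns the strip over; this is what separates the
  -- Möbius strip from the annulus.
  have hflip : ∀ y : ℝ, flip N y = 1 - y := fun y => by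
    rw [flip, if_neg (by rw [Int.not_even_iff_odd]; exact_mod_cast hodd)]
  have hcompact : CompactSpace MobiusStrip := Quot.compactSpace
  refine isCopies_pushforward isConnectedTiling_strip baryCoord_strip hinj
    (q := Quot.mk mobiusRel) isQuotientMap_quot_mk
    (g := fun z : unitInterval × unitInterval => (((N : ℝ) * z.1, z.2) : ℝ × unitInterval)) (by fun_prop) (fun p => ?_) ?_
  -- `[0, N] × [0, 1]` is a fundamental domain: the glide reflection by `N * n` carries a point of
  -- it to `p`.
  · obtain ⟨n, hn0, hn1⟩ : ∃ n : ℤ, (n : ℝ) ≤ p.1 / N ∧ p.1 / N < n + 1 :=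
      ⟨⌊p.1 / N⌋, Int.floor_le _, Int.lt_floor_add_one _⟩
    refine ⟨(⟨p.1 / N - n, by linarith, by linarith⟩, ⟨flip (N * n) p.2, flip_mem _ p.2.2⟩),
      N * n, (stripHom_eq_zero_iff _ _ _).2 (dvd_mul_right _ _), ?_⟩
    ext
    · simp only [stripAct]
      push_cast
      field_simp
      ring
    · simp only [stripAct, flip_flip]
  · intro v z z'
    constructor
    · have hr : ∀ z z' : unitInterval × unitInterval, mobiusRel z z' →
          develop (stripHom l k) v stripHat ((N : ℝ) * z.1, z.2) =
          develop (stripHom l k) v stripHat ((N : ℝ) * z'.1, z'.2) := by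
        rintro z z' ⟨h0, h1, h2⟩
        refine (develop_eq_iff baryCoord_strip hinj v).2
          ⟨N, (stripHom_eq_zero_iff _ _ _).2 dvd_rfl, ?_⟩
        ext
        · simp [stripAct, h0, h1]
        · simp [stripAct, hflip, h2]
      -- `mobiusRel` is not itself an equivalence relation. Lifting the developing map to the
      -- quotient avoids describing the equivalence it generates.
      exact fun hz => congrArg (Quot.lift (fun z : unitInterval × unitInterval =>
        develop (stripHom l k) v stripHat ((N : ℝ) * z.1, z.2)) hr) hz
    · intro hz
      obtain ⟨d, hd, he⟩ := (develop_eq_iff baryCoord_strip hinj v).1 hz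
      obtain ⟨n, rfl⟩ := (stripHom_eq_zero_iff _ _ _).1 hd
      rw [← hN] at he
      simp only [stripAct, Prod.mk.injEq] at he
      obtain ⟨he1, he2⟩ := he
      have he1' : (z'.1 : ℝ) = z.1 + n := by
        push_cast at he1
        have : (N : ℝ) * z'.1 = N * (z.1 + n) := by linarith
        exact mul_left_cancel₀ hNpos.ne' this
      have hz0 := z.1.2
      have hz1 := z'.1.2
      have hn1 : (n : ℝ) ≤ 1 := by linarith [hz0.1, hz1.2]
      have hn2 : (-1 : ℝ) ≤ n := by linarith [hz0.2, hz1.1]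
      have hn1' : n ≤ 1 := by exact_mod_cast hn1
      have hn2' : -1 ≤ n := by exact_mod_cast hn2
      -- For `n = 1` and `n = -1` the two points are forced onto opposite vertical sides of the
      -- square, where `mobiusRel` applies in one direction or the other.
      obtain rfl | rfl | rfl : n = 0 ∨ n = 1 ∨ n = -1 := by omega
      · congr 1
        ext
        · simpa using he1'.symm
        · rw [← he2]
          simp [flip]
      · refine Quot.sound ⟨?_, ?_, ?_⟩
        · ext
          push_cast at he1' ⊢
          linarith [hz0.1, hz1.2]
        · ext
          push_cast at he1' ⊢
          linarith [hz0.1, hz1.2]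
        · rw [← he2]
          ext
          simp [hflip]
      · refine (Quot.sound ⟨?_, ?_, ?_⟩).symm
        · ext
          push_cast at he1' ⊢
          linarith [hz0.2, hz1.1]
        · ext
          push_cast at he1' ⊢
          linarith [hz0.2, hz1.1]
        · rw [← he2]
          ext
          have : flip (-(N : ℤ)) = flip N := by
            funext y
            simp [flip]
          simp [this, hflip]

end Strip

/-! ### The triangulated plane and its map to `ℤ/k` -/

section Plane

/-- The barycentric coordinate of the origin in the triangulation of the plane by the lines
`x ∈ ℤ`, `y ∈ ℤ`, `x - y ∈ ℤ`. -/
noncomputable def hexTent (x y : ℝ) : ℝ := max 0 (1 - max (max |x| |y|) |x - y|)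

theorem hexTent_comm (x y : ℝ) : hexTent x y = hexTent y x := by
  rw [hexTent, hexTent, max_comm |x| |y|, abs_sub_comm]

/-- The hypotheses cut out the triangle with vertices `(0, 0)`, `(1, 0)`, `(1, 1)`. The triangle
above the diagonal is obtained later from the symmetry `hexTent_comm`. -/
theorem hexTent_zero {x y : ℝ} (h0 : 0 ≤ y) (h1 : y ≤ x) (h2 : x ≤ 1) : hexTent x y = 1 - x := by
  have h : max (max |x| |y|) |x - y| = x := by
    rw [abs_of_nonneg h0, abs_of_nonneg (h0.trans h1), abs_of_nonneg (by linarith), max_eq_left h1,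
      max_eq_left (by linarith)]
  rw [hexTent, h, max_eq_right (by linarith)]

theorem hexTent_one {x y : ℝ} (h0 : 0 ≤ y) (h1 : y ≤ x) (h2 : x ≤ 1) :
    hexTent (x - 1) y = x - y := by
  have h : max (max |x - 1| |y|) |x - 1 - y| = 1 - (x - y) := by
    rw [max_eq_right]
    · rw [abs_of_nonpos (by linarith)]; ring
    · rw [abs_of_nonneg h0, abs_of_nonpos (by linarith), abs_of_nonpos (by linarith)]
      exact max_le (by linarith) (by linarith)
  rw [hexTent, h, max_eq_right (by linarith)]
  ring

theorem hexTent_two {x y : ℝ} (h0 : 0 ≤ y) (h1 : y ≤ x) (h2 : x ≤ 1) :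
    hexTent (x - 1) (y - 1) = y := by
  have h : max (max |x - 1| |y - 1|) |x - 1 - (y - 1)| = 1 - y := by
    rw [abs_of_nonpos (by linarith), abs_of_nonpos (by linarith), abs_of_nonneg (by linarith),
      max_eq_right (a := -(x - 1)) (by linarith), max_eq_left (by linarith)]
    ring
  rw [hexTent, h, max_eq_right (by linarith)]
  ring

theorem hexTent_eq_zero {x y : ℝ} (h : 1 ≤ |x| ∨ 1 ≤ |y| ∨ 1 ≤ |x - y|) : hexTent x y = 0 := by
  refine max_eq_left (sub_nonpos.2 ?_)
  simpa [or_assoc] using h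

theorem hexTent_eq_zero_of_far {x y : ℝ} (h0 : 0 ≤ y) (h1 : y ≤ x) (h2 : x ≤ 1) {m n : ℤ}
    (hne0 : ¬(m = 0 ∧ n = 0)) (hne1 : ¬(m = 1 ∧ n = 0)) (hne2 : ¬(m = 1 ∧ n = 1)) :
    hexTent (x - m) (y - n) = 0 := by
  apply hexTent_eq_zero
  rcases (by omega : m ≤ -1 ∨ 2 ≤ m ∨ n ≤ -1 ∨ 2 ≤ n ∨ (m = 0 ∧ n = 1)) with
    h | h | h | h | ⟨rfl, rfl⟩
  · have h' : (m : ℝ) ≤ -1 := by exact_mod_cast h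
    exact Or.inl (le_abs.2 (Or.inl (by linarith)))
  · have h' : (2 : ℝ) ≤ m := by exact_mod_cast h
    exact Or.inl (le_abs.2 (Or.inr (by linarith)))
  · have h' : (n : ℝ) ≤ -1 := by exact_mod_cast h
    exact Or.inr (Or.inl (le_abs.2 (Or.inl (by linarith))))
  · have h' : (2 : ℝ) ≤ n := by exact_mod_cast h
    exact Or.inr (Or.inl (le_abs.2 (Or.inr (by linarith))))
  · refine Or.inr (Or.inr (le_abs.2 (Or.inl ?_)))
    push_cast
    linarith

/-- The barycentric coordinates on the plane with vertices `ℤ × ℤ`. -/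
noncomputable def planeHat (c : ℤ × ℤ) (p : ℝ × ℝ) : ℝ := hexTent (p.1 - c.1) (p.2 - c.2)

/-- Translation of the plane by an integral vector. -/
def planeAct (d : ℤ × ℤ) (p : ℝ × ℝ) : ℝ × ℝ := (d.1 + p.1, d.2 + p.2)

/-- The vertices of the two triangles in the unit square with lower left corner `c`. -/
def planeVert : (ℤ × ℤ) × Bool → Fin 3 → ℤ × ℤ
  | (c, false) => ![c, c + (1, 0), c + (1, 1)]
  | (c, true) => ![c, c + (0, 1), c + (1, 1)]

theorem planeVert_injective (i : (ℤ × ℤ) × Bool) : Function.Injective (planeVert i) := by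
  obtain ⟨⟨a, b⟩, _ | _⟩ := i <;> intro x y h <;> fin_cases x <;> fin_cases y <;>
    simp [planeVert] at h ⊢

theorem planeHat_add (c d : ℤ × ℤ) (p : ℝ × ℝ) :
    planeHat (c + d) p = hexTent (p.1 - c.1 - d.1) (p.2 - c.2 - d.2) := by
  simp only [planeHat, Prod.fst_add, Prod.snd_add, Int.cast_add, sub_sub]

theorem planeHat_values_lower {c : ℤ × ℤ} {p : ℝ × ℝ} (h0 : 0 ≤ p.2 - c.2)
    (h1 : p.2 - c.2 ≤ p.1 - c.1) (h2 : p.1 - c.1 ≤ 1) :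
    HatValues planeHat (planeVert (c, false)) (1 - (p.1 - c.1)) (p.1 - c.1 - (p.2 - c.2))
      (p.2 - c.2) p where
  val₀ := hexTent_zero h0 h1 h2
  val₁ := by
    refine (planeHat_add c (1, 0) p).trans ?_
    simpa using hexTent_one h0 h1 h2
  val₂ := by
    refine (planeHat_add c (1, 1) p).trans ?_
    simpa using hexTent_two h0 h1 h2
  other d hd0 hd1 hd2 := by
    obtain ⟨⟨m, n⟩, rfl⟩ : ∃ m, d = c + m := ⟨d - c, by abel⟩
    rw [planeHat_add]
    refine hexTent_eq_zero_of_far h0 h1 h2 ?_ ?_ ?_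
    · rintro ⟨rfl, rfl⟩
      exact hd0 (by simp [planeVert])
    · rintro ⟨rfl, rfl⟩
      exact hd1 (by simp [planeVert])
    · rintro ⟨rfl, rfl⟩
      exact hd2 (by simp [planeVert])

theorem planeHat_swap (c : ℤ × ℤ) (p : ℝ × ℝ) : planeHat c.swap p.swap = planeHat c p :=
  hexTent_comm _ _

theorem planeVert_swap (c : ℤ × ℤ) (i : Fin 3) :
    (planeVert (c, true) i).swap = planeVert (c.swap, false) i := by
  fin_cases i <;> simp [planeVert]

theorem planeHat_values_upper {c : ℤ × ℤ} {p : ℝ × ℝ} (h0 : 0 ≤ p.1 - c.1)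
    (h1 : p.1 - c.1 ≤ p.2 - c.2) (h2 : p.2 - c.2 ≤ 1) :
    HatValues planeHat (planeVert (c, true)) (1 - (p.2 - c.2)) (p.2 - c.2 - (p.1 - c.1))
      (p.1 - c.1) p := by
  have h := planeHat_values_lower (c := c.swap) (p := p.swap) h0 h1 h2
  refine ⟨?_, ?_, ?_, fun d hd0 hd1 hd2 => ?_⟩
  · rw [← planeHat_swap, planeVert_swap, h.val₀]; rfl
  · rw [← planeHat_swap, planeVert_swap, h.val₁]; rfl
  · rw [← planeHat_swap, planeVert_swap, h.val₂]; rfl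
  · rw [← planeHat_swap]
    refine h.other _ ?_ ?_ ?_ <;> rw [← planeVert_swap] <;>
      simpa only [ne_eq, Prod.swap_inj]

theorem locallyFinite_planeHat : LocallyFinite fun c => Function.support (planeHat c) := by
  intro p
  refine ⟨{z | |z.1 - p.1| < 1 ∧ |z.2 - p.2| < 1}, ?_, ?_⟩
  · refine IsOpen.mem_nhds ((isOpen_lt (by fun_prop) continuous_const).and
      (isOpen_lt (by fun_prop) continuous_const)) ?_
    simp
  · have key : ∀ (x z : ℝ) (a : ℤ), |z - x| < 1 → |z - a| < 1 →
        a ∈ Set.Icc (⌊x⌋ - 2) (⌊x⌋ + 3) := by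
      intro x z a h1 h2
      rw [abs_lt] at h1 h2
      have := Int.floor_le x
      have := Int.lt_floor_add_one x
      constructor
      · have : (⌊x⌋ : ℝ) - 2 < a := by linarith
        exact_mod_cast this.le
      · have : (a : ℝ) < ⌊x⌋ + 3 := by linarith
        exact_mod_cast this.le
    refine ((Set.finite_Icc (⌊p.1⌋ - 2) (⌊p.1⌋ + 3)).prod
      (Set.finite_Icc (⌊p.2⌋ - 2) (⌊p.2⌋ + 3))).subset ?_
    rintro c ⟨z, hz, hz1, hz2⟩
    have hc1 : |z.1 - c.1| < 1 := by
      by_contra hn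
      exact hz (hexTent_eq_zero (Or.inl (not_lt.1 hn)))
    have hc2 : |z.2 - c.2| < 1 := by
      by_contra hn
      exact hz (hexTent_eq_zero (Or.inr (Or.inl (not_lt.1 hn))))
    exact ⟨key _ _ _ hz1 hc1, key _ _ _ hz2 hc2⟩

theorem continuous_hexTent : Continuous fun p : ℝ × ℝ => hexTent p.1 p.2 := by
  unfold hexTent
  fun_prop

theorem baryCoord_plane : BaryCoord planeHat planeAct (triangles planeVert) := by
  refine BaryCoord.of_triangles planeVert_injective (fun c => ((c.1 : ℝ), (c.2 : ℝ))) (coord := id)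
    Function.injective_id (fun c => ?_) locallyFinite_planeHat (fun c p => le_max_left _ _)
    (fun c d p => ?_) (fun p => ?_) fun i x₀ x₁ x₂ h0 h1 h2 hs => ?_
  · exact continuous_hexTent.comp (f := fun p : ℝ × ℝ => (p.1 - c.1, p.2 - c.2)) (by fun_prop)
  · rw [planeHat_add]
    simp only [planeHat, planeAct]
    congr 1 <;> ring
  · obtain ⟨a, ha0, ha1⟩ : ∃ a : ℤ, (a : ℝ) ≤ p.1 ∧ p.1 < a + 1 :=
      ⟨⌊p.1⌋, Int.floor_le _, Int.lt_floor_add_one _⟩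
    obtain ⟨b, hb0, hb1⟩ : ∃ b : ℤ, (b : ℝ) ≤ p.2 ∧ p.2 < b + 1 :=
      ⟨⌊p.2⌋, Int.floor_le _, Int.lt_floor_add_one _⟩
    rcases le_total (p.2 - b) (p.1 - a) with h | h
    · refine ⟨((a, b), false), _, _, _, by ring,
        planeHat_values_lower (by dsimp only; linarith) h (by dsimp only; linarith), ?_⟩
      ext <;> simp [planeVert] <;> ring
    · refine ⟨((a, b), true), _, _, _, by ring,
        planeHat_values_upper (by dsimp only; linarith) h (by dsimp only; linarith), ?_⟩
      ext <;> simp [planeVert] <;> ring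
  · obtain ⟨c, _ | _⟩ := i
    · refine ⟨(c.1 + (x₁ + x₂), c.2 + x₂), ?_⟩
      have := @planeHat_values_lower c (c.1 + (x₁ + x₂), c.2 + x₂)
        (by simp only; linarith) (by simp only; linarith) (by simp only; linarith)
      convert this using 1 <;> simp only <;> linarith
    · refine ⟨(c.1 + x₂, c.2 + (x₁ + x₂)), ?_⟩
      have := @planeHat_values_upper c (c.1 + x₂, c.2 + (x₁ + x₂))
        (by simp only; linarith) (by simp only; linarith) (by simp only; linarith)
      convert this using 1 <;> simp only <;> linarith

theorem isConnectedTiling_plane : IsConnectedTiling (triangles planeVert) where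
  nonempty := by
    rintro _ ⟨c, rfl⟩
    exact ⟨_, Finset.mem_insert_self _ _⟩
  translate := by
    rintro _ ⟨⟨c, b⟩, rfl⟩ a
    refine ⟨(a + c, b), ?_⟩
    cases b <;> simp [Finset.image_insert, planeVert, add_assoc]
  cover := ⟨_, ⟨(0, false), rfl⟩, by simp [planeVert]⟩
  gen := ⟨{(1, 0), (0, 1)}, (AddSubgroup.eq_top_iff' _).2 fun n =>
    AddSubgroup.mem_closure_pair.2 ⟨n.1, n.2, by simp⟩, by
    rintro _ (rfl | rfl)
    · exact ⟨_, ⟨(0, false), rfl⟩, by simp [planeVert], by simp [planeVert]⟩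
    · exact ⟨_, ⟨(0, true), rfl⟩, by simp [planeVert], by simp [planeVert]⟩⟩

/-- The homomorphism `(x, y) ↦ x l + y j` from `ℤ × ℤ` to `ℤ/k`. -/
def planeHom (l j k : ℕ) : ℤ × ℤ →+ ZMod k :=
  (zmultiplesHom (ZMod k) (l : ZMod k)).coprod (zmultiplesHom (ZMod k) (j : ZMod k))

theorem planeHom_apply (l j k : ℕ) (c : ℤ × ℤ) : planeHom l j k c = c.1 * l + c.2 * j := by
  simp [planeHom]

theorem planeHom_eq_zero_iff (l j k : ℕ) (c : ℤ × ℤ) :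
    planeHom l j k c = 0 ↔ (k : ℤ) ∣ c.1 * l + c.2 * j := by
  rw [planeHom_apply, ← ZMod.intCast_zmod_eq_zero_iff_dvd]
  push_cast
  rfl

/-- A vertex of the star of the origin. -/
def InHexagon (c : ℤ × ℤ) : Prop :=
  -1 ≤ c.1 ∧ c.1 ≤ 1 ∧ -1 ≤ c.2 ∧ c.2 ≤ 1 ∧ -1 ≤ c.1 - c.2 ∧ c.1 - c.2 ≤ 1

theorem sub_mem_plane {σ : Finset (ℤ × ℤ)} (hσ : σ ∈ triangles planeVert) {s c : ℤ × ℤ}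
    (hs : s ∈ σ) (hc : c ∈ σ) : InHexagon (c - s) := by
  obtain ⟨⟨a, _ | _⟩, rfl⟩ := hσ <;>
  · simp only [planeVert, Matrix.cons_val_zero, Matrix.cons_val_one, Matrix.cons_val,
      Finset.mem_insert, Finset.mem_singleton] at hs hc
    rcases hs with rfl | rfl | rfl <;> rcases hc with rfl | rfl | rfl <;> simp [InHexagon]

/-- The kernel of `planeHom l j k` meets the doubled hexagon only in 0, so the star of a vertex maps
injectively. -/
theorem InHexagon.eq_of_dvd {l j k : ℕ} (hk : Odd k) (hl : 1 ≤ l) (hlj : l < j)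
    (hjk : j < k - l - j) {c d : ℤ × ℤ} (hc : InHexagon c) (hd : InHexagon d)
    (h : (k : ℤ) ∣ (c.1 - d.1) * l + (c.2 - d.2) * j) : c = d := by
  obtain ⟨n, rfl⟩ := hk
  obtain ⟨x, y⟩ := c
  obtain ⟨z, w⟩ := d
  simp only [InHexagon] at hc hd h
  obtain ⟨q, hq⟩ := h
  -- Here `2 * n + 1` is `k`. The bound `2 (l + j) < 2 k` leaves only the multiples `-k`, `0` and
  -- `k`.
  have hlt : |(x - z) * l + (y - w) * j| < 2 * (2 * n + 1) := by
    obtain ⟨hc1, hc2, hc3, hc4, hc5, hc6⟩ := hc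
    obtain ⟨hd1, hd2, hd3, hd4, hd5, hd6⟩ := hd
    rw [abs_lt]
    have hx : -2 ≤ x - z ∧ x - z ≤ 2 := by omega
    have hy : -2 ≤ y - w ∧ y - w ≤ 2 := by omega
    have h1 : (x - z) * l ≤ 2 * l := by nlinarith
    have h2 : -2 * l ≤ (x - z) * l := by nlinarith
    have h3 : (y - w) * j ≤ 2 * j := by nlinarith
    have h4 : -2 * j ≤ (y - w) * j := by nlinarith
    constructor <;> omega
  have hq1 : -1 ≤ q ∧ q ≤ 1 := by
    rw [hq, abs_lt] at hlt
    push_cast at hlt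
    constructor <;> nlinarith
  obtain ⟨hq1, hq2⟩ := hq1
  obtain ⟨hc1, hc2, hc3, hc4, hc5, hc6⟩ := hc
  obtain ⟨hd1, hd2, hd3, hd4, hd5, hd6⟩ := hd
  obtain ⟨u, rfl⟩ : ∃ u, x = z + u := ⟨x - z, by ring⟩
  obtain ⟨v, rfl⟩ : ∃ v, y = w + v := ⟨y - w, by ring⟩
  rw [add_sub_cancel_left, add_sub_cancel_left] at hq
  have hu1 : -2 ≤ u := by omega
  have hu2 : u ≤ 2 := by omega
  have hv1 : -2 ≤ v := by omega
  have hv2 : v ≤ 2 := by omega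
  -- In the equation `u l + v j = q k`, the value `q = 0` would force `l = j`, since `|u - v| ≤ 2`.
  -- For `q = 1` the sum is either too small or gives `2 l + j = k` or `l + 2 j = k`, against `l < j
  -- < k - l - j`, or makes `k` even. The case `q = -1` is symmetric.
  have huv : u = 0 ∧ v = 0 := by
    interval_cases u <;> interval_cases v <;> interval_cases q <;> omega
  rw [huv.1, huv.2, add_zero, add_zero]

theorem starInjective_plane {l j k : ℕ} (hk : Odd k) (hl : 1 ≤ l) (hlj : l < j)
    (hjk : j < k - l - j) : StarInjective (planeHom l j k) (triangles planeVert) := by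
  intro σ hσ τ hτ s hs t ht hst c hc c' hc' hcc
  refine InHexagon.eq_of_dvd hk hl hlj hjk (sub_mem_plane hσ hs hc) (sub_mem_plane hτ ht hc') ?_
  have h3 : planeHom l j k (c - s - (c' - t)) = 0 := by
    simp only [map_sub, hst, hcc, sub_self]
  rw [planeHom_eq_zero_iff] at h3
  exact h3

theorem image_planeHom_lower (l j k : ℕ) (v : ZMod k) (c : ℤ × ℤ) :
    ({planeVert (c, false) 0, planeVert (c, false) 1, planeVert (c, false) 2} :
      Finset (ℤ × ℤ)).image (fun d => v + planeHom l j k d) =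
      {v + planeHom l j k c, v + planeHom l j k c + l, v + planeHom l j k c + l + j} := by
  have h1 : planeHom l j k (1, 0) = l := by simp [planeHom_apply]
  have h2 : planeHom l j k (1, 1) = l + j := by simp [planeHom_apply]
  simp [Finset.image_insert, planeVert, h1, h2, add_assoc]

theorem image_planeHom_upper (l j k : ℕ) (v : ZMod k) (c : ℤ × ℤ) :
    ({planeVert (c, true) 0, planeVert (c, true) 1, planeVert (c, true) 2} :
      Finset (ℤ × ℤ)).image (fun d => v + planeHom l j k d) =
      {v + planeHom l j k c, v + planeHom l j k c + j, v + planeHom l j k c + j + l} := by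
  have h1 : planeHom l j k (0, 1) = j := by simp [planeHom_apply]
  have h2 : planeHom l j k (1, 1) = j + l := by simp [planeHom_apply, add_comm]
  simp [Finset.image_insert, planeVert, h1, h2, add_assoc]

/-- Rotating `(l : c : j)` to `(j : l : c)` exhibits the two cycles as the two ways round the
parallelogram spanned by `l` and `j`, which are the images of the two triangles in a unit square. -/
theorem diffCycle_union_eq_pushforward {l j c k : ℕ} (h : l + j + c = k) :
    diffCycle k ![l, j, c] ∪ diffCycle k ![l, c, j] =
      pushforward (planeHom l j k) (triangles planeVert) := by
  rw [diffCycle_rotate (by omega : l + c + j = k), diffCycle_rotate (by omega : c + j + l = k),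
    diffCycle_three, diffCycle_three]
  ext s
  constructor
  · rintro (⟨t, rfl⟩ | ⟨t, rfl⟩)
    · refine ⟨t, _, ⟨(0, false), rfl⟩, ?_⟩
      rw [image_planeHom_lower, map_zero, add_zero]
    · refine ⟨t, _, ⟨(0, true), rfl⟩, ?_⟩
      rw [image_planeHom_upper, map_zero, add_zero]
  · rintro ⟨t, _, ⟨⟨a, _ | _⟩, rfl⟩, rfl⟩
    · exact Or.inl ⟨t + planeHom l j k a, (image_planeHom_lower l j k t a).symm⟩
    · exact Or.inr ⟨t + planeHom l j k a, (image_planeHom_upper l j k t a).symm⟩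

theorem S_eq_pushforward {l j k : ℕ} (h : l + j ≤ k) :
    S l j k = pushforward (planeHom l j k) (triangles planeVert) :=
  diffCycle_union_eq_pushforward (by omega)

end Plane

/-! ### Lattice quotients and the torus pieces -/

section Torus

/-- A subgroup of `ℤ × ℤ` of finite exponent has a triangular basis. -/
theorem exists_triangular_basis (Λ : AddSubgroup (ℤ × ℤ)) {k : ℤ} (hk : k ≠ 0)
    (h1 : (k, 0) ∈ Λ) (h2 : (0, k) ∈ Λ) :
    ∃ a b d : ℤ, a ≠ 0 ∧ d ≠ 0 ∧ ∀ c, c ∈ Λ ↔ ∃ m n : ℤ, c = (m * a + n * b, n * d) := by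
  -- `a` generates the intersection with the first axis and `d` the projection to the second. Any
  -- lift `(b, d)` of `d` completes the basis.
  obtain ⟨a, ha⟩ := Int.subgroup_cyclic (Λ.comap (AddMonoidHom.inl ℤ ℤ))
  obtain ⟨d, hd⟩ := Int.subgroup_cyclic (Λ.map (AddMonoidHom.snd ℤ ℤ))
  have ha' : ∀ x, (x, (0 : ℤ)) ∈ Λ ↔ ∃ m : ℤ, m * a = x := fun x => by
    have : x ∈ Λ.comap (AddMonoidHom.inl ℤ ℤ) ↔ ∃ m : ℤ, m * a = x := by
      rw [ha, AddSubgroup.mem_closure_singleton]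
      simp only [smul_eq_mul]
    exact this
  have hd' : ∀ y, (∃ x, (x, y) ∈ Λ) ↔ ∃ n : ℤ, n * d = y := fun y => by
    have : y ∈ Λ.map (AddMonoidHom.snd ℤ ℤ) ↔ ∃ n : ℤ, n * d = y := by
      rw [hd, AddSubgroup.mem_closure_singleton]
      simp only [smul_eq_mul]
    rw [← this]
    constructor
    · rintro ⟨x, hx⟩
      exact ⟨_, hx, rfl⟩
    · rintro ⟨⟨x, y⟩, hx, rfl⟩
      exact ⟨x, hx⟩
  obtain ⟨b, hb⟩ := (hd' d).2 ⟨1, one_mul d⟩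
  refine ⟨a, b, d, ?_, ?_, ?_⟩
  · rintro rfl
    obtain ⟨m, hm⟩ := (ha' k).1 h1
    exact hk (by rw [← hm, mul_zero])
  · rintro rfl
    obtain ⟨m, hm⟩ := (hd' k).1 ⟨0, h2⟩
    exact hk (by rw [← hm, mul_zero])
  · rintro ⟨x, y⟩
    have hnb : ∀ n : ℤ, (n * b, n * d) ∈ Λ := fun n => by
      have := Λ.zsmul_mem hb n
      simpa using this
    constructor
    · intro hc
      obtain ⟨n, rfl⟩ := (hd' y).1 ⟨x, hc⟩
      have := Λ.sub_mem hc (hnb n)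
      rw [Prod.mk_sub_mk, sub_self] at this
      obtain ⟨m, hm⟩ := (ha' _).1 this
      exact ⟨m, n, by rw [hm, sub_add_cancel]⟩
    · rintro ⟨m, n, he⟩
      rw [he]
      have := Λ.add_mem ((ha' (m * a)).2 ⟨m, rfl⟩) (hnb n)
      simpa using this

theorem unitAddCircle_coe_eq_iff (x y : ℝ) :
    (x : UnitAddCircle) = y ↔ ∃ n : ℤ, x + n = y := by
  rw [QuotientAddGroup.eq, AddSubgroup.mem_zmultiples_iff]
  refine exists_congr fun n => ?_
  rw [zsmul_eq_mul, mul_one, eq_neg_add_iff_add_eq]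

theorem isCopies_S {l j k : ℕ} (hk : Odd k) (hl : 1 ≤ l) (hlj : l < j) (hjk : j < k - l - j) :
    IsCopies (generated (S l j k)) (planeHom l j k).range.index (Nat.card (planeHom l j k).range)
      Torus := by
  rw [S_eq_pushforward (by omega)]
  have hinj := starInjective_plane hk hl hlj hjk
  obtain ⟨a, b, d, ha, hd, hker⟩ := exists_triangular_basis (planeHom l j k).ker
    (k := k) (by omega) (by rw [AddMonoidHom.mem_ker, planeHom_eq_zero_iff]; simp)
    (by rw [AddMonoidHom.mem_ker, planeHom_eq_zero_iff]; simp)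
  have ha' : (a : ℝ) ≠ 0 := by exact_mod_cast ha
  have hd' : (d : ℝ) ≠ 0 := by exact_mod_cast hd
  have hq : Topology.IsQuotientMap (Prod.map (fun x : ℝ => (x : UnitAddCircle))
      (fun x : ℝ => (x : UnitAddCircle))) :=
    (QuotientAddGroup.isOpenQuotientMap_mk.prodMap
      QuotientAddGroup.isOpenQuotientMap_mk).isQuotientMap
  refine isCopies_pushforward isConnectedTiling_plane baryCoord_plane hinj hq
    (g := fun z : ℝ × ℝ => (z.1 * a + z.2 * b, z.2 * d)) (by fun_prop) (fun p => ?_) ?_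
  · refine ⟨((p.1 - p.2 / d * b) / a, p.2 / d), 0, map_zero _, ?_⟩
    ext
    · simp only [planeAct]
      field_simp
      simp
    · simp only [planeAct]
      field_simp
      simp
  · rintro v ⟨s, t⟩ ⟨s', t'⟩
    rw [develop_eq_iff baryCoord_plane hinj v]
    simp only [Prod.map_apply, Prod.mk.injEq, unitAddCircle_coe_eq_iff, planeAct]
    constructor
    · rintro ⟨⟨m, rfl⟩, ⟨n, rfl⟩⟩
      refine ⟨(m * a + n * b, n * d), (hker _).2 ⟨m, n, rfl⟩, ?_, ?_⟩ <;> push_cast <;> ring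
    · rintro ⟨c, hc, h1, h2⟩
      obtain ⟨m, n, rfl⟩ := (hker c).1 hc
      push_cast at h1 h2
      have ht : t + n = t' := mul_right_cancel₀ hd' (by linarith)
      subst ht
      exact ⟨⟨m, mul_right_cancel₀ ha' (by linarith)⟩, n, rfl⟩

end Torus

/-! ### Ranges, indices and orders in `ℤ/k` -/

section Range

variable {k : ℕ}

theorem range_stripHom (l k : ℕ) : (stripHom l k).range = AddSubgroup.zmultiples (l : ZMod k) :=
  rfl

/-- By Bézout, `l` and `j` generate the same subgroup as their gcd, which reduces order and index to
the cyclic case. -/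
theorem range_planeHom (l j k : ℕ) :
    (planeHom l j k).range = AddSubgroup.zmultiples ((l.gcd j : ℕ) : ZMod k) := by
  apply le_antisymm
  · rintro _ ⟨c, rfl⟩
    rw [planeHom_apply]
    obtain ⟨x, hx⟩ := l.gcd_dvd_left j
    obtain ⟨y, hy⟩ := l.gcd_dvd_right j
    refine AddSubgroup.mem_zmultiples_iff.2 ⟨c.1 * x + c.2 * y, ?_⟩
    have hx' : (l : ZMod k) = (l.gcd j : ℕ) * x := by
      rw [← Nat.cast_mul, ← hx]
    have hy' : (j : ZMod k) = (l.gcd j : ℕ) * y := by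
      rw [← Nat.cast_mul, ← hy]
    rw [zsmul_eq_mul, hx', hy']
    push_cast
    ring
  · rw [AddSubgroup.zmultiples_le]
    refine ⟨(l.gcdA j, l.gcdB j), ?_⟩
    have h := congrArg (Int.cast : ℤ → ZMod k) (Nat.gcd_eq_gcd_ab l j)
    rw [planeHom_apply]
    push_cast at h ⊢
    rw [h]
    ring

theorem card_zmultiples_natCast (hk : k ≠ 0) (a : ℕ) :
    Nat.card (AddSubgroup.zmultiples (a : ZMod k)) = k / a.gcd k := by
  rw [Nat.card_zmultiples, ZMod.addOrderOf_coe a hk, Nat.gcd_comm]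

theorem index_zmultiples_natCast (hk : k ≠ 0) (a : ℕ) :
    (AddSubgroup.zmultiples (a : ZMod k)).index = a.gcd k := by
  have h := (AddSubgroup.zmultiples (a : ZMod k)).card_mul_index
  rw [card_zmultiples_natCast hk, Nat.card_zmod] at h
  have h' := Nat.div_mul_cancel (Nat.gcd_dvd_right a k)
  have hpos : 0 < k / a.gcd k := Nat.div_pos (Nat.gcd_le_right _ (Nat.pos_of_ne_zero hk))
    (Nat.gcd_pos_of_pos_right _ (Nat.pos_of_ne_zero hk))
  exact Nat.eq_of_mul_eq_mul_left hpos (h.trans h'.symm)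

/-- The order divides `k`, so it is prime to 6, and it is not 1 because `0 < l < k`. The least such
number is 5. -/
theorem addOrderOf_natCast_spec (hmod : k % 6 = 1 ∨ k % 6 = 5) {l : ℕ} (hl : 0 < l) (hlk : l < k) :
    5 ≤ addOrderOf (l : ZMod k) ∧ Odd (addOrderOf (l : ZMod k)) := by
  have hdvd : addOrderOf (l : ZMod k) ∣ k := by
    rw [ZMod.addOrderOf_coe l (by omega)]
    exact Nat.div_dvd_of_dvd (Nat.gcd_dvd_left k l)
  have h2 : ¬ 2 ∣ addOrderOf (l : ZMod k) := fun h => by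
    have := h.trans hdvd
    omega
  have h3 : ¬ 3 ∣ addOrderOf (l : ZMod k) := fun h => by
    have := h.trans hdvd
    omega
  have h1 : addOrderOf (l : ZMod k) ≠ 1 := by
    rw [Ne, AddMonoid.addOrderOf_eq_one_iff, ZMod.natCast_eq_zero_iff]
    exact Nat.not_dvd_of_pos_of_lt hl hlk
  rw [← Nat.not_even_iff_odd, even_iff_two_dvd]
  refine ⟨?_, h2⟩
  have h0 : addOrderOf (l : ZMod k) ≠ 0 := fun h => h2 (h ▸ dvd_zero 2)
  omega

end Range

end CyclicSurf

theorem theorem2 (k : ℕ) (hk : 1 < k) (hmod : k % 6 = 1 ∨ k % 6 = 5) :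
    -- the number of pieces of either kind
    ((CyclicSurf.mobiusIndex k).card : ℚ) = ((k : ℚ) - 1) / 2 ∧
    ((CyclicSurf.torusIndex k).card : ℚ) = ((k : ℚ) ^ 2 - 6 * k + 5) / 12 ∧
    -- the pieces partition the triangles of the simplex with vertex set `ℤ/k`
    CyclicSurf.skel 2 (⊤ : PreAbstractSimplicialComplex (ZMod k)) =
      (⋃ l ∈ CyclicSurf.mobiusIndex k, CyclicSurf.M l k) ∪
        (⋃ p ∈ CyclicSurf.torusIndex k, CyclicSurf.S p.1 p.2 k) ∧
    (∀ l ∈ CyclicSurf.mobiusIndex k, ∀ l' ∈ CyclicSurf.mobiusIndex k, l ≠ l' →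
      Disjoint (CyclicSurf.M l k) (CyclicSurf.M l' k)) ∧
    (∀ p ∈ CyclicSurf.torusIndex k, ∀ q ∈ CyclicSurf.torusIndex k, p ≠ q →
      Disjoint (CyclicSurf.S p.1 p.2 k) (CyclicSurf.S q.1 q.2 k)) ∧
    (∀ l ∈ CyclicSurf.mobiusIndex k, ∀ p ∈ CyclicSurf.torusIndex k,
      Disjoint (CyclicSurf.M l k) (CyclicSurf.S p.1 p.2 k)) ∧
    -- the topological type of the pieces
    (∀ l ∈ CyclicSurf.mobiusIndex k,
      CyclicSurf.IsCopies (CyclicSurf.generated (CyclicSurf.M l k))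
        (Nat.gcd l k) (k / Nat.gcd l k) CyclicSurf.MobiusStrip) ∧
    (∀ p ∈ CyclicSurf.torusIndex k,
      CyclicSurf.IsCopies (CyclicSurf.generated (CyclicSurf.S p.1 p.2 k))
        (Nat.gcd (Nat.gcd p.1 p.2) k) (k / Nat.gcd (Nat.gcd p.1 p.2) k) CyclicSurf.Torus) := by
  have h2 : k % 2 = 1 := by omega
  have hk0 : k ≠ 0 := by omega
  refine ⟨CyclicSurf.card_mobiusIndex h2, CyclicSurf.card_torusIndex hmod,
    CyclicSurf.skel_two_eq_union hk, fun l hl l' hl' => CyclicSurf.disjoint_M_M hmod hl hl',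
    fun p hp q hq => CyclicSurf.disjoint_S_S hp hq, fun l hl p hp => CyclicSurf.disjoint_M_S hl hp,
    fun l hl => ?_, fun p hp => ?_⟩
  · rw [CyclicSurf.mem_mobiusIndex] at hl
    obtain ⟨h5, hodd⟩ :=
      CyclicSurf.addOrderOf_natCast_spec hmod (by omega : 0 < l) (by omega : l < k)
    have h := CyclicSurf.isCopies_M h5 hodd
    rwa [CyclicSurf.range_stripHom, CyclicSurf.index_zmultiples_natCast hk0,
      CyclicSurf.card_zmultiples_natCast hk0] at h
  · rw [CyclicSurf.mem_torusIndex] at hp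
    have h := CyclicSurf.isCopies_S (Nat.odd_iff.2 h2) hp.1 hp.2.1 hp.2.2
    rwa [CyclicSurf.range_planeHom, CyclicSurf.index_zmultiples_natCast hk0,
      CyclicSurf.card_zmultiples_natCast hk0] at h
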